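/- Let $(\mathcal A,\boldsymbol\alpha)$ be a weighted system: real $d\times d$ matrices $A_1,\dots,A_m$ with weights $\alpha_1,\dots,\alpha_m>0$. A product $A_{j_k}\cdots A_{j_1}$ is identified with its word $j_k\cdots j_1$, i.e. with a vertex of the tree of products whose root is the empty word; its weight is $|\cdot|=\alpha_{j_k}+\cdots+\alpha_{j_1}$. Let $\Pi$ be a nonempty product that is not a power of a shorter product and whose spectral radius $\rho(\Pi)$ is positive. Put $\rho_c=\rho(\Pi)^{1/|\Pi|}$ and $\tilde A_i=\rho_c^{-\alpha_i}A_i$, and denote by $\tilde w$ the product of the matrices $\tilde A_i$ along a word $w$. The product $\Pi$ is called *dominant* if there is $\gamma<1$ such that $\rho(\tilde w)<\gamma$ for every word $w$ that is neither a power of $\Pi$ nor a power of a cyclic permutation of $\Pi$. The leading eigenvalue of $\Pi$ is *unique and simple* if exactly one complex eigenvalue of $\Pi$ has modulus $\rho(\Pi)$ and its algebraic multiplicity is one. A real leading eigenvector is a vector $v_0\in\mathbb R^d\setminus\{0\}$ with $\Pi v_0=cv_0$, $c\in\mathbb R$, $|c|=\rho(\Pi)$. The *invariant polytope algorithm* started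 with a real leading eigenvector $v_0$ of $\Pi$ works as follows. Put $\mathcal V_0=\{v_0\}$ and let $\mathcal R_0$ consist of the root of the tree. In iteration $k\ge1$, set $\mathcal V_k=\mathcal V_{k-1}$ and $\mathcal R_k=\emptyset$, and visit, one after the other, the children $w'=iw$ of the vertices $w\in\mathcal R_{k-1}$, $i=1,\dots,m$: if $w'=\Pi$ (so that $\tilde w'v_0=\pm v_0$, the path is back at the root), or if $\tilde w'v_0$ lies in the interior of the absolutely convex hull of the current set $\mathcal V_k$, nothing is changed; otherwise $\tilde w'v_0$ is added to $\mathcal V_k$ and $w'$ to $\mathcal R_k$. The algorithm terminates within finite time if $\mathcal R_k=\emptyset$ for some $k$. **Theorem.** Let $v_0$ be a real leading eigenvector of $\Pi$ that lies in no proper linear subspace of $\mathbb R^d$ invariant under all $A_1,\dots,A_m$ (this holds automatically if $\mathcal A$ is irreducible). Then the invariant polytope algorithm started with $v_0$ terminates within finite time if and only if $\Pi$ is dominant and its leading eigenvalue is unique and simple. Moreover, if the leading eigenvalue of $\Pi$ is unique and simple, then $\Pi$ has a real leading eigenvector, so the algorithm can be started. -/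

import Mathlib

open scoped Matrix

noncomputable section

/-- A weighted system: modes `A i`, real `d × d` matrices, with weights `α i > 0`. -/
structure WeightedSystem (d m : ℕ) where
  A : Fin m → Matrix (Fin d) (Fin d) ℝ
  α : Fin m → ℝ
  α_pos : ∀ i, 0 < α i

/-- The (complex) spectral radius of a real matrix. -/
def matSpectralRadius {d : ℕ} (M : Matrix (Fin d) (Fin d) ℝ) : ℝ :=
  (spectralRadius ℂ (M.map (algebraMap ℝ ℂ))).toReal

/-- Exactly one complex eigenvalue has the largest modulus, and it is a simple root of the
characteristic polynomial. -/
def HasUniqueSimpleLeadingEigenvalue {d : ℕ} (M : Matrix (Fin d) (Fin d) ℝ) : Prop :=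
  ∃ z : ℂ, ‖z‖ = matSpectralRadius M ∧
    (M.map (algebraMap ℝ ℂ)).charpoly.rootMultiplicity z = 1 ∧
    ∀ y : ℂ, (M.map (algebraMap ℝ ℂ)).charpoly.IsRoot y → ‖y‖ = matSpectralRadius M → y = z

/-- `v` is a (real) leading eigenvector of `M`. -/
def IsLeadingEigenvector {d : ℕ} (M : Matrix (Fin d) (Fin d) ℝ) (v : Fin d → ℝ) : Prop :=
  v ≠ 0 ∧ ∃ c : ℝ, |c| = matSpectralRadius M ∧ M *ᵥ v = c • v

/-- `p` is a nonempty word that is not a power of a shorter word. -/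
def IsSimpleWord {m : ℕ} (p : List (Fin m)) : Prop :=
  p ≠ [] ∧ ∀ (u : List (Fin m)) (k : ℕ), u.length < p.length → (List.replicate k u).flatten ≠ p

/-- `w` is a power of `p` or of a cyclic permutation of `p`. -/
def IsPowerOfCyclicPerm {m : ℕ} (p w : List (Fin m)) : Prop :=
  ∃ u : List (Fin m), u ~r p ∧ ∃ k : ℕ, w = (List.replicate k u).flatten

/-- State of the algorithm inside an iteration: the set `V` of vertices found so far, and the list
`R` of the tree nodes added during the current iteration. -/
structure IPAState (d m : ℕ) where
  V : Set (Fin d → ℝ)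
  R : List (List (Fin m))

namespace WeightedSystem

variable {d m : ℕ}

/-- The product `A(k) ⋯ A(1)` of the word `[j(k), …, j(1)]`: the last letter acts first. -/
def product (S : WeightedSystem d m) (w : List (Fin m)) : Matrix (Fin d) (Fin d) ℝ :=
  (w.map S.A).prod

/-- The total weight `α(k) + ⋯ + α(1)` of a word. -/
def weight (S : WeightedSystem d m) (w : List (Fin m)) : ℝ :=
  (w.map S.α).sum

/-- The dilation: every mode `A i` is replaced by `r ^ (α i) • A i`. -/
def dilate (S : WeightedSystem d m) (r : ℝ) : WeightedSystem d m where
  A := fun i => r ^ S.α i • S.A i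
  α := S.α
  α_pos := S.α_pos

/-- The candidate value `ρ(p) ^ (1 / |p|)`. -/
def candidateRadius (S : WeightedSystem d m) (p : List (Fin m)) : ℝ :=
  matSpectralRadius (S.product p) ^ (1 / S.weight p)

/-- The system normalized with respect to the candidate product `p`. -/
def normalized (S : WeightedSystem d m) (p : List (Fin m)) : WeightedSystem d m :=
  S.dilate (S.candidateRadius p)⁻¹

/-- `p` is dominant: the normalized products other than the powers of `p` and of its cyclic
permutations have spectral radii bounded by some `γ < 1`. -/
def IsDominant (S : WeightedSystem d m) (p : List (Fin m)) : Prop :=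
  ∃ γ : ℝ, γ < 1 ∧ ∀ w : List (Fin m), ¬ IsPowerOfCyclicPerm p w →
    matSpectralRadius ((S.normalized p).product w) < γ

/-- No proper subspace that is invariant under all the modes contains `v`. -/
def IsCyclicVector (S : WeightedSystem d m) (v : Fin d → ℝ) : Prop :=
  ∀ W : Submodule ℝ (Fin d → ℝ), (∀ i, ∀ x ∈ W, S.A i *ᵥ x ∈ W) → v ∈ W → W = ⊤

/-- The vector carried by the node `w` of the tree of products. -/
def ipaVector (S : WeightedSystem d m) (p : List (Fin m)) (v₀ : Fin d → ℝ)
    (w : List (Fin m)) : Fin d → ℝ :=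
  (S.normalized p).product w *ᵥ v₀

open Classical in
/-- Visit of the node `w`. It is left out if its vector is interior to the current absolutely
convex hull, or if it is the node `p`, where the path along the candidate product is back at the
root (its vector is `± v₀`). Otherwise it is added. -/
def ipaVisit (S : WeightedSystem d m) (p : List (Fin m)) (v₀ : Fin d → ℝ)
    (st : IPAState d m) (w : List (Fin m)) : IPAState d m :=
  if w = p ∨ S.ipaVector p v₀ w ∈ interior (absConvexHull ℝ st.V) then st
  else ⟨insert (S.ipaVector p v₀ w) st.V, st.R ++ [w]⟩

/-- One iteration of the main loop: starting from `V` unchanged and no new nodes, visit all the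
children `i :: w` of the nodes `w` added by the previous iteration, one after the other. -/
def ipaIterate (S : WeightedSystem d m) (p : List (Fin m)) (v₀ : Fin d → ℝ)
    (st : IPAState d m) : IPAState d m :=
  (st.R.flatMap fun w => (List.finRange m).map fun i => i :: w).foldl (S.ipaVisit p v₀) ⟨st.V, []⟩

/-- The state after `k` iterations, started from `V = {v₀}` and the root of the tree. -/
def ipaRun (S : WeightedSystem d m) (p : List (Fin m)) (v₀ : Fin d → ℝ) (k : ℕ) : IPAState d m :=
  (S.ipaIterate p v₀)^[k] ⟨{v₀}, [[]]⟩

/-- The algorithm halts after finitely many iterations: some iteration adds no node. -/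
def IPATerminates (S : WeightedSystem d m) (p : List (Fin m)) (v₀ : Fin d → ℝ) : Prop :=
  ∃ k : ℕ, (S.ipaRun p v₀ k).R = []

end WeightedSystem

end

/-! Normalize so that `Π` has spectral radius one and `Π v₀ = ± v₀`. Two reductions serve both
directions. Deflation: with `f ⬝ᵥ v₀ = 1`, the leading eigenvalue `c` is unique and simple iff `Π -
c v₀ fᵀ` has smaller spectral radius. Uniform gap: if `M` contracts a seminorm `N` and has spectral
radius at most `γ < 1`, then `N x ≤ K N(± x - M x)` with `K` depending only on `γ` and the dimension
(`exists_seminorm_le_mul_sub`).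

Sufficiency. Take an infinite path of products that never meets the word `p` of `Π` and along which
a contracted seminorm of `v₀` does not decay. By compactness the path comes back close to itself. By
the gap, the segments between such times are powers of cyclic permutations of `p`, so the path ends
in `… p p p s`, and deflation drives it towards multiples `l • v₀`. The words `p … p s` are not
exceptional themselves, so the gap applied to them forces `|l| ≤ 1 - η`
(`exists_pathWord_near_smul`). This is used twice. If the system were unbounded, an extremal
seminorm, a limit of rescaled orbit norms of the contracted systems, would produce such a path with
seminorm at least `N v₀`, a contradiction; so the system is bounded. If the algorithm ran forever,
König's lemma would give such a path staying outside the interior of a polytope that contains `v₀`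
and is a neighbourhood of zero, although it approaches `l • v₀`.

Necessity. A terminating run leaves a finite tree and a polytope whose gauge is contracted by all
modes. From a node `u`, a long run either enters a shrunken polytope, by a factor `θ < 1`, or
returns through powers of `p`, giving a word equation `w … w u = u' p … p`. Periodicity of words
turns this equation into `w` being a power of a cyclic permutation of `p`, and for `w = p` into `u =
[]`. Hence any other `w` has a power, of exponent independent of `w`, that contracts by `θ`, which
is dominance; and a power of `Π` contracts modulo the line of `v₀`, which is simplicity and
uniqueness. -/

open Filter Topology Polynomial

/-! ### Spectral radius of real matrices and decay of powers. -/

section SpectralRadius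

variable {d : ℕ}

theorem isRoot_charpoly_iff_exists_eigenvector (M : Matrix (Fin d) (Fin d) ℂ) (z : ℂ) :
    M.charpoly.IsRoot z ↔ ∃ y : Fin d → ℂ, y ≠ 0 ∧ M *ᵥ y = z • y := by
  have h : M.charpoly.IsRoot z ↔ (Matrix.scalar (Fin d) z - M).det = 0 := by
    rw [Polynomial.IsRoot, Matrix.eval_charpoly]
  rw [h, ← Matrix.exists_mulVec_eq_zero_iff]
  refine exists_congr fun y => and_congr_right fun _ => ?_
  rw [Matrix.sub_mulVec, sub_eq_zero, Matrix.scalar_apply, ← Matrix.smul_one_eq_diagonal,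
    Matrix.smul_mulVec, Matrix.one_mulVec, eq_comm]

/-- Guarantees that `toReal` in `matSpectralRadius` loses nothing; the value `⊤` would become `0`.
-/
theorem spectralRadius_ne_top (M : Matrix (Fin d) (Fin d) ℂ) : spectralRadius ℂ M ≠ ⊤ := by
  let := Matrix.linftyOpNormedRing (n := Fin d) (α := ℂ)
  let := Matrix.linftyOpNormedAlgebra (n := Fin d) (R := ℂ) (α := ℂ)
  have : CompleteSpace (Matrix (Fin d) (Fin d) ℂ) := FiniteDimensional.complete ℂ _
  rcases isEmpty_or_nonempty (Fin d) with h | h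
  · simp
  · have : NormOneClass (Matrix (Fin d) (Fin d) ℂ) := Matrix.linfty_opNormOneClass
    exact ne_top_of_le_ne_top ENNReal.coe_ne_top (spectrum.spectralRadius_le_nnnorm (𝕜 := ℂ) M)

theorem norm_le_matSpectralRadius {M : Matrix (Fin d) (Fin d) ℝ} {z : ℂ}
    (hz : (M.map (algebraMap ℝ ℂ)).charpoly.IsRoot z) : ‖z‖ ≤ matSpectralRadius M := by
  have h : (‖z‖₊ : ENNReal) ≤ spectralRadius ℂ (M.map (algebraMap ℝ ℂ)) :=
    le_iSup₂ (f := fun (k : ℂ) (_ : k ∈ spectrum ℂ (M.map (algebraMap ℝ ℂ))) => (‖k‖₊ : ENNReal))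
      z (Matrix.mem_spectrum_of_isRoot_charpoly hz)
  have := ENNReal.toReal_mono (spectralRadius_ne_top _) h
  simpa [matSpectralRadius] using this

theorem exists_isRoot_norm_eq_matSpectralRadius (hd : 0 < d) (M : Matrix (Fin d) (Fin d) ℝ) :
    ∃ z : ℂ, (M.map (algebraMap ℝ ℂ)).charpoly.IsRoot z ∧ ‖z‖ = matSpectralRadius M := by
  let := Matrix.linftyOpNormedRing (n := Fin d) (α := ℂ)
  let := Matrix.linftyOpNormedAlgebra (n := Fin d) (R := ℂ) (α := ℂ)
  have : CompleteSpace (Matrix (Fin d) (Fin d) ℂ) := FiniteDimensional.complete ℂ _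
  have : Nonempty (Fin d) := ⟨⟨0, hd⟩⟩
  obtain ⟨z, hz, h⟩ := spectrum.exists_nnnorm_eq_spectralRadius (M.map (algebraMap ℝ ℂ))
  refine ⟨z, Matrix.mem_spectrum_iff_isRoot_charpoly.1 hz, ?_⟩
  rw [matSpectralRadius, ← h]
  simp

theorem matSpectralRadius_nonneg (M : Matrix (Fin d) (Fin d) ℝ) : 0 ≤ matSpectralRadius M :=
  ENNReal.toReal_nonneg

theorem matSpectralRadius_of_dim_zero (hd : d = 0) (M : Matrix (Fin d) (Fin d) ℝ) :
    matSpectralRadius M = 0 := by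
  subst hd
  simp [matSpectralRadius]

/-- Gives the invariance of the spectral radius under cyclic permutations of a word. -/
theorem matSpectralRadius_mul_comm (A B : Matrix (Fin d) (Fin d) ℝ) :
    matSpectralRadius (A * B) = matSpectralRadius (B * A) := by
  have : spectrum ℂ ((A * B).map (algebraMap ℝ ℂ)) = spectrum ℂ ((B * A).map (algebraMap ℝ ℂ)) := by
    ext z
    rw [Matrix.mem_spectrum_iff_isRoot_charpoly, Matrix.mem_spectrum_iff_isRoot_charpoly,
      Matrix.map_mul, Matrix.map_mul, Matrix.charpoly_mul_comm]
  simp only [matSpectralRadius, spectralRadius, this]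

theorem matSpectralRadius_pow_le (M : Matrix (Fin d) (Fin d) ℝ) (k : ℕ)
    (h : matSpectralRadius M ≤ 1) : matSpectralRadius (M ^ k) ≤ 1 := by
  rcases Nat.eq_zero_or_pos d with hd | hd
  · rw [matSpectralRadius_of_dim_zero hd]; norm_num
  obtain ⟨z, hz, hzn⟩ := exists_isRoot_norm_eq_matSpectralRadius hd (M ^ k)
  rw [← hzn]
  have : Nonempty (Fin d) := ⟨⟨0, hd⟩⟩
  rw [← Matrix.mem_spectrum_iff_isRoot_charpoly] at hz
  have e : (M ^ k).map (algebraMap ℝ ℂ) = (M.map (algebraMap ℝ ℂ)) ^ k :=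
    map_pow (algebraMap ℝ ℂ).mapMatrix M k
  rw [e, spectrum.map_pow_of_nonempty
    (spectrum.nonempty_of_isAlgClosed_of_finiteDimensional ℂ _)] at hz
  obtain ⟨y, hy, rfl⟩ := hz
  rw [Matrix.mem_spectrum_iff_isRoot_charpoly] at hy
  simp only [norm_pow]
  exact pow_le_one₀ (norm_nonneg _) ((norm_le_matSpectralRadius hy).trans h)

theorem matSpectralRadius_smul (c : ℝ) (M : Matrix (Fin d) (Fin d) ℝ) :
    matSpectralRadius (c • M) = |c| * matSpectralRadius M := by
  rcases Nat.eq_zero_or_pos d with hd | hd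
  · simp [matSpectralRadius_of_dim_zero hd]
  have e : (c • M).map (algebraMap ℝ ℂ) = (c : ℂ) • M.map (algebraMap ℝ ℂ) := by
    ext i j; simp
  apply le_antisymm
  · obtain ⟨z, hz, hzn⟩ := exists_isRoot_norm_eq_matSpectralRadius hd (c • M)
    rw [← hzn]
    obtain ⟨y, hy, h⟩ := (isRoot_charpoly_iff_exists_eigenvector _ _).1 hz
    rw [e, Matrix.smul_mulVec] at h
    rcases eq_or_ne c 0 with rfl | hc
    · have : z • y = 0 := by rw [← h]; simp
      have : z = 0 := by simpa [hy] using this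
      simp [this]
    · have hc' : (c : ℂ) ≠ 0 := by exact_mod_cast hc
      have h2 : (M.map (algebraMap ℝ ℂ)).charpoly.IsRoot ((c : ℂ)⁻¹ * z) := by
        rw [isRoot_charpoly_iff_exists_eigenvector]
        exact ⟨y, hy, by rw [mul_smul, ← h, smul_smul, inv_mul_cancel₀ hc', one_smul]⟩
      have h3 := norm_le_matSpectralRadius h2
      rw [norm_mul, norm_inv, Complex.norm_real, Real.norm_eq_abs] at h3
      have := abs_pos.2 hc
      rwa [inv_mul_le_iff₀ this] at h3
  · obtain ⟨z, hz, hzn⟩ := exists_isRoot_norm_eq_matSpectralRadius hd M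
    rw [← hzn]
    obtain ⟨y, hy, h⟩ := (isRoot_charpoly_iff_exists_eigenvector _ _).1 hz
    have h2 : ((c • M).map (algebraMap ℝ ℂ)).charpoly.IsRoot ((c : ℂ) * z) := by
      rw [isRoot_charpoly_iff_exists_eigenvector]
      exact ⟨y, hy, by rw [e, Matrix.smul_mulVec, h, smul_smul]⟩
    have h3 := norm_le_matSpectralRadius h2
    rwa [norm_mul, Complex.norm_real, Real.norm_eq_abs] at h3

/-- An eigenvalue of modulus at least one keeps its complex eigenvector from shrinking under any
power, so decay along a single sequence of exponents suffices. Decay is known on real vectors only,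
hence the detour through matrix entries. -/
theorem matSpectralRadius_lt_one_of_tendsto (hd : 0 < d) {M : Matrix (Fin d) (Fin d) ℝ}
    {f : ℕ → ℕ} (h : ∀ x, Tendsto (fun j => M ^ f j *ᵥ x) atTop (𝓝 0)) :
    matSpectralRadius M < 1 := by
  obtain ⟨z, hz, hzn⟩ := exists_isRoot_norm_eq_matSpectralRadius hd M
  rw [← hzn]
  by_contra! hz1
  obtain ⟨y, hy, he⟩ := (isRoot_charpoly_iff_exists_eigenvector _ _).1 hz
  have hpow : ∀ n, (M.map (algebraMap ℝ ℂ)) ^ n *ᵥ y = z ^ n • y := by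
    intro n
    induction n with
    | zero => simp
    | succ n ih => rw [pow_succ, ← Matrix.mulVec_mulVec, he, Matrix.mulVec_smul, ih, smul_smul,
        pow_succ']
  have hent : ∀ i k, Tendsto (fun j => (M ^ f j) i k) atTop (𝓝 0) := by
    intro i k
    have := (tendsto_pi_nhds.1 (h (Pi.single k 1))) i
    simpa using this
  obtain ⟨i, hi⟩ := Function.ne_iff.1 hy
  have hlim : Tendsto (fun j => z ^ f j * y i) atTop (𝓝 0) := by
    have h1 : ∀ j, z ^ f j * y i = ∑ k, (((M ^ f j) i k : ℝ) : ℂ) * y k := by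
      intro j
      have := congrFun (hpow (f j)) i
      have e : (M.map (algebraMap ℝ ℂ)) ^ f j = (M ^ f j).map (algebraMap ℝ ℂ) :=
        (map_pow (algebraMap ℝ ℂ).mapMatrix M _).symm
      rw [e] at this
      simpa [Matrix.mulVec, dotProduct] using this.symm
    simp_rw [h1]
    have : Tendsto (fun j => ∑ k, (((M ^ f j) i k : ℝ) : ℂ) * y k) atTop
        (𝓝 (∑ k, ((0 : ℝ) : ℂ) * y k)) := by
      refine tendsto_finsetSum _ fun k _ => Tendsto.mul_const _ ?_
      exact (Complex.continuous_ofReal.tendsto 0).comp (hent i k)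
    simpa using this
  have h2 := hlim.norm
  rw [norm_zero] at h2
  have h3 : ‖y i‖ ≤ 0 := by
    refine ge_of_tendsto h2 (Eventually.of_forall fun j => ?_)
    rw [norm_mul, norm_pow]
    exact le_mul_of_one_le_left (norm_nonneg _) (one_le_pow₀ hz1)
  exact hi (norm_le_zero_iff.1 h3)

/-- Gelfand's formula over `ℂ`, read entrywise over `ℝ`. -/
theorem tendsto_pow_mulVec_of_matSpectralRadius_lt_one {M : Matrix (Fin d) (Fin d) ℝ}
    (h : matSpectralRadius M < 1) (x : Fin d → ℝ) :
    Tendsto (fun n => M ^ n *ᵥ x) atTop (𝓝 0) := by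
  let := Matrix.linftyOpNormedRing (n := Fin d) (α := ℂ)
  let := Matrix.linftyOpNormedAlgebra (n := Fin d) (R := ℂ) (α := ℂ)
  have : CompleteSpace (Matrix (Fin d) (Fin d) ℂ) := FiniteDimensional.complete ℂ _
  set N := M.map (algebraMap ℝ ℂ) with hN
  obtain ⟨r, hr1, hr2⟩ := exists_between h
  have hr0 : 0 ≤ r := (matSpectralRadius_nonneg M).trans hr1.le
  have hlt : spectralRadius ℂ N < ENNReal.ofReal r := by
    rw [← ENNReal.ofReal_toReal (spectralRadius_ne_top N)]
    exact (ENNReal.ofReal_lt_ofReal_iff (lt_of_le_of_lt (matSpectralRadius_nonneg M) hr1)).2 hr1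
  have hev := (spectrum.pow_norm_pow_one_div_tendsto_nhds_spectralRadius N).eventually_lt_const hlt
  have hnorm : Tendsto (fun n => ‖N ^ n‖) atTop (𝓝 0) := by
    refine squeeze_zero' (Eventually.of_forall fun n => norm_nonneg _) ?_
      (tendsto_pow_atTop_nhds_zero_of_lt_one hr0 hr2)
    filter_upwards [hev, eventually_gt_atTop 0] with n hn hn0
    have h1 : ‖N ^ n‖ ^ (1 / n : ℝ) ≤ r := by
      by_contra! hc
      exact absurd hn (not_lt.2 (ENNReal.ofReal_le_ofReal hc.le))
    calc ‖N ^ n‖ = (‖N ^ n‖ ^ (1 / n : ℝ)) ^ n := by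
          rw [one_div, Real.rpow_inv_natCast_pow (norm_nonneg _) hn0.ne']
      _ ≤ r ^ n := pow_le_pow_left₀ (by positivity) h1 n
  have hzero : Tendsto (fun n => N ^ n) atTop (𝓝 0) := tendsto_zero_iff_norm_tendsto_zero.2 hnorm
  rw [tendsto_pi_nhds]
  intro i
  have h1 : ∀ k, Tendsto (fun n => (M ^ n) i k) atTop (𝓝 0) := by
    intro k
    have h2 : Tendsto (fun n => ((N ^ n) i k).re) atTop (𝓝 0) := by
      have : Continuous fun A : Matrix (Fin d) (Fin d) ℂ => (A i k).re :=
        Complex.continuous_re.comp (continuous_id.matrix_elem i k)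
      simpa [Function.comp_def] using (this.tendsto 0).comp hzero
    refine h2.congr fun n => ?_
    have e : N ^ n = (M ^ n).map (algebraMap ℝ ℂ) :=
      (map_pow (algebraMap ℝ ℂ).mapMatrix M _).symm
    rw [e]; simp
  have : Tendsto (fun n => ∑ k, (M ^ n) i k * x k) atTop (𝓝 (∑ k, 0 * x k)) :=
    tendsto_finsetSum _ fun k _ => (h1 k).mul_const _
  simpa [Matrix.mulVec, dotProduct] using this

end SpectralRadius

/-! ### Rank-one deflation of the leading eigenvalue. -/

section Deflation

variable {d : ℕ}

/-- Deflation replaces one eigenvalue `c` by `0`. For the characteristic matrix `A` one has `A v =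
(X - c) v`, hence `(X - c) adj(A) v = det A • v`, and the matrix determinant lemma gives the
identity. -/
theorem charpoly_sub_vecMulVec (M : Matrix (Fin d) (Fin d) ℝ) {v f : Fin d → ℝ} {c : ℝ}
    (hv : M *ᵥ v = c • v) (hf : f ⬝ᵥ v = 1) :
    (M - c • Matrix.vecMulVec v f).charpoly * (X - C c) = M.charpoly * X := by
  set A := M.charmatrix with hA
  let v' : Fin d → ℝ[X] := fun i => C (v i)
  let f' : Fin d → ℝ[X] := fun i => C (f i)
  have hfv : f' ⬝ᵥ v' = 1 := by
    have : f' ⬝ᵥ v' = C (f ⬝ᵥ v) := by simp [dotProduct, f', v']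
    rw [this, hf, C_1]
  have hAv : A *ᵥ v' = (X - C c) • v' := by
    have h1 : (C.mapMatrix M) *ᵥ v' = C c • v' := by
      ext1 i
      have := congrArg (C : ℝ → ℝ[X]) (congrFun hv i)
      simpa [Matrix.mulVec, dotProduct, v'] using this
    rw [hA, Matrix.charmatrix, Matrix.sub_mulVec, h1, sub_smul]
    congr 1
    rw [Matrix.scalar_apply, ← Matrix.smul_one_eq_diagonal, Matrix.smul_mulVec, Matrix.one_mulVec]
  have hchar : (M - c • Matrix.vecMulVec v f).charmatrix =
      A + C c • Matrix.vecMulVec v' f' := by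
    ext1 i j
    simp only [hA, Matrix.charmatrix_apply, Matrix.add_apply, Matrix.smul_apply,
      Matrix.vecMulVec_apply, Matrix.sub_apply, smul_eq_mul, v', f', C_sub, C_mul]
    ring
  have hadj : (X - C c) • (A.adjugate *ᵥ v') = A.det • v' := by
    rw [← Matrix.mulVec_smul, ← hAv, Matrix.mulVec_mulVec, Matrix.adjugate_mul,
      Matrix.smul_mulVec, Matrix.one_mulVec]
  -- The determinant lemma is applied to an invertible matrix, so it is proved over the fraction
  -- field and pulled back.
  have hrank : ∀ (B : Matrix (Fin d) (Fin d) ℝ[X]) (u w : Fin d → ℝ[X]), B.det ≠ 0 →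
      (B + Matrix.vecMulVec u w).det = B.det + w ⬝ᵥ (B.adjugate *ᵥ u) := by
    intro B u w hB
    let K := FractionRing ℝ[X]
    have hinj : Function.Injective (algebraMap ℝ[X] K) := IsFractionRing.injective ℝ[X] K
    apply hinj
    let φ := algebraMap ℝ[X] K
    let B' := φ.mapMatrix B
    have hB' : IsUnit B'.det := by
      rw [isUnit_iff_ne_zero, ← RingHom.map_det]
      exact fun h => hB (hinj (by rw [h, map_zero]))
    have h1 := Matrix.det_add_replicateCol_mul_replicateRow (ι := Unit) hB' (φ ∘ u) (φ ∘ w)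
    have h2 : φ.mapMatrix (B + Matrix.vecMulVec u w) = B' +
        Matrix.replicateCol Unit (φ ∘ u) * Matrix.replicateRow Unit (φ ∘ w) := by
      rw [map_add]
      congr 1
      ext i j
      simp [Matrix.vecMulVec_apply, Matrix.mul_apply]
    rw [RingHom.map_det, h2, h1]
    have h3 : (1 + Matrix.replicateRow Unit (φ ∘ w) * B'⁻¹ * Matrix.replicateCol Unit (φ ∘ u)).det
        = 1 + (φ ∘ w) ⬝ᵥ (B'⁻¹ *ᵥ (φ ∘ u)) := by
      rw [Matrix.det_unique]
      simp only [Matrix.add_apply, Matrix.one_apply_eq, add_right_inj]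
      rw [Matrix.mul_assoc]
      simp [Matrix.mul_apply, Matrix.mulVec, dotProduct]
    have h4 : B'.det • B'⁻¹ = B'.adjugate := by
      rw [Matrix.inv_def, smul_smul, Ring.mul_inverse_cancel _ hB', one_smul]
    rw [h3, mul_add, mul_one, ← smul_eq_mul, ← dotProduct_smul, ← Matrix.smul_mulVec,
      h4, map_add, RingHom.map_det]
    congr 1
    rw [← RingHom.map_adjugate]
    simp [Matrix.mulVec, dotProduct, φ]
  have hdet : A.det ≠ 0 := M.charpoly_monic.ne_zero
  have hsmul : C c • Matrix.vecMulVec v' f' = Matrix.vecMulVec (C c • v') f' := by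
    rw [Matrix.smul_vecMulVec]
  rw [Matrix.charpoly, hchar, hsmul, hrank A _ _ hdet, Matrix.charpoly, ← hA]
  have hkey : (X - C c) * (f' ⬝ᵥ (A.adjugate *ᵥ v')) = A.det := by
    rw [← smul_eq_mul, ← dotProduct_smul, hadj, dotProduct_smul, hfv, smul_eq_mul, mul_one]
  rw [Matrix.mulVec_smul, dotProduct_smul, smul_eq_mul]
  linear_combination C c * hkey

/-- The leading eigenvalue is unique and simple exactly when removing the leading eigenvector
decreases the spectral radius. -/
theorem hasUniqueSimpleLeadingEigenvalue_iff_deflation (hd : 0 < d)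
    {M : Matrix (Fin d) (Fin d) ℝ} {v f : Fin d → ℝ} {c : ℝ} (hc : |c| = matSpectralRadius M)
    (hpos : 0 < matSpectralRadius M) (hv : M *ᵥ v = c • v) (hf : f ⬝ᵥ v = 1) :
    HasUniqueSimpleLeadingEigenvalue M ↔
      matSpectralRadius (M - c • Matrix.vecMulVec v f) < matSpectralRadius M := by
  set M' := M - c • Matrix.vecMulVec v f with hM'
  have hchar : (M'.map (algebraMap ℝ ℂ)).charpoly * (X - C (c : ℂ)) =
      (M.map (algebraMap ℝ ℂ)).charpoly * X := by
    have := congrArg (Polynomial.map (algebraMap ℝ ℂ)) (charpoly_sub_vecMulVec M hv hf)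
    rw [Matrix.charpoly_map, Matrix.charpoly_map]
    simpa [Polynomial.map_mul] using this
  set χ' := (M'.map (algebraMap ℝ ℂ)).charpoly with hχ'
  set χ := (M.map (algebraMap ℝ ℂ)).charpoly with hχ
  have hχ0 : χ ≠ 0 := (Matrix.charpoly_monic _).ne_zero
  have hχ'0 : χ' ≠ 0 := (Matrix.charpoly_monic _).ne_zero
  have hcn : ‖(c : ℂ)‖ = matSpectralRadius M := by rw [Complex.norm_real, Real.norm_eq_abs, hc]
  have hc0 : (c : ℂ) ≠ 0 := norm_pos_iff.1 (by rw [hcn]; exact hpos)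
  have heval : ∀ y, χ'.eval y * (y - c) = χ.eval y * y := by
    intro y
    have := congrArg (Polynomial.eval y) hchar
    simpa using this
  -- Since `c ≠ 0`, the factor `X` does not contribute at `c`.
  have hmult : χ'.rootMultiplicity (c : ℂ) + 1 = χ.rootMultiplicity (c : ℂ) := by
    have h1 : (χ' * (X - C (c : ℂ))).rootMultiplicity (c : ℂ) = χ'.rootMultiplicity (c : ℂ) + 1 := by
      rw [rootMultiplicity_mul (mul_ne_zero hχ'0 (X_sub_C_ne_zero _)), rootMultiplicity_X_sub_C_self]
    have h2 : (χ * X).rootMultiplicity (c : ℂ) = χ.rootMultiplicity (c : ℂ) := by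
      rw [rootMultiplicity_mul (mul_ne_zero hχ0 X_ne_zero)]
      have : (X : ℂ[X]).rootMultiplicity (c : ℂ) = 0 := by
        apply rootMultiplicity_eq_zero
        simpa using hc0
      rw [this, add_zero]
    rw [← h1, ← h2, hchar]
  have hcroot : χ.IsRoot c := by
    rw [← rootMultiplicity_pos hχ0]
    omega
  constructor
  · rintro ⟨z, -, hz1, hz2⟩
    have hcz := hz2 c hcroot hcn
    rw [← hcz, ← hmult] at hz1
    obtain ⟨y, hy, hyn⟩ := exists_isRoot_norm_eq_matSpectralRadius hd M'
    rw [← hyn]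
    by_contra! hle
    have hy0 : y ≠ 0 := norm_pos_iff.1 (hpos.trans_le hle)
    have hyr : χ.IsRoot y := by
      have := heval y
      rw [show χ'.eval y = 0 from hy, zero_mul] at this
      exact (mul_eq_zero.1 this.symm).resolve_right hy0
    have hyc : y = c := (hz2 y hyr (le_antisymm (norm_le_matSpectralRadius hyr) hle)).trans hcz.symm
    have : 0 < χ'.rootMultiplicity (c : ℂ) := (rootMultiplicity_pos hχ'0).2 (hyc ▸ hy)
    omega
  · intro hlt
    have hnot : ∀ y, ‖y‖ = matSpectralRadius M → χ'.eval y ≠ 0 := fun y hy h0 =>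
      absurd (norm_le_matSpectralRadius (M := M') (z := y) h0) (by rw [hy]; exact not_le.2 hlt)
    refine ⟨c, hcn, ?_, fun y hy hyn => ?_⟩
    · rw [← hmult, rootMultiplicity_eq_zero (hnot c hcn)]
    · have := heval y
      rw [show χ.eval y = 0 from hy, zero_mul] at this
      exact sub_eq_zero.1 ((mul_eq_zero.1 this).resolve_left (hnot y hyn))

/-- The conjugate of the leading eigenvalue is an eigenvalue of the same modulus, so uniqueness
makes the eigenvalue real. -/
theorem HasUniqueSimpleLeadingEigenvalue.exists_isLeadingEigenvector
    {M : Matrix (Fin d) (Fin d) ℝ} (h : HasUniqueSimpleLeadingEigenvalue M) :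
    ∃ v : Fin d → ℝ, IsLeadingEigenvector M v := by
  obtain ⟨z, hzn, hz1, hz2⟩ := h
  have hroot : (M.map (algebraMap ℝ ℂ)).charpoly.IsRoot z := by
    rw [← rootMultiplicity_pos (Matrix.charpoly_monic _).ne_zero]
    omega
  have hconj : (M.map (algebraMap ℝ ℂ)).charpoly.IsRoot (starRingEnd ℂ z) := by
    rw [Matrix.charpoly_map] at hroot ⊢
    rw [IsRoot, eval_map_algebraMap] at hroot ⊢
    rw [aeval_conj, hroot, map_zero]
  have hreal := hz2 _ hconj (by rw [RCLike.norm_conj, hzn])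
  obtain ⟨c, rfl⟩ := Complex.conj_eq_iff_real.1 hreal
  have hc : M.charpoly.IsRoot c := by
    rw [Matrix.charpoly_map, IsRoot, eval_map_algebraMap] at hroot
    have : aeval (algebraMap ℝ ℂ c) M.charpoly = 0 := hroot
    rw [aeval_algebraMap_apply] at this
    simpa using this
  have hdet : (Matrix.scalar (Fin d) c - M).det = 0 := by
    rw [← Matrix.eval_charpoly]; exact hc
  obtain ⟨v, hv0, hv⟩ := Matrix.exists_mulVec_eq_zero_iff.2 hdet
  refine ⟨v, hv0, c, by rw [← hzn, Complex.norm_real, Real.norm_eq_abs], ?_⟩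
  rw [Matrix.sub_mulVec, sub_eq_zero, Matrix.scalar_apply, ← Matrix.smul_one_eq_diagonal,
    Matrix.smul_mulVec, Matrix.one_mulVec] at hv
  exact hv.symm

end Deflation

/-! ### The uniform gap for contractions of a seminorm. -/

section Resolvent

variable {d : ℕ}

theorem seminorm_sub_pow_mulVec_le {N : Seminorm ℝ (Fin d → ℝ)} {M : Matrix (Fin d) (Fin d) ℝ}
    (hN : ∀ x, N (M *ᵥ x) ≤ N x) (x : Fin d → ℝ) (k : ℕ) :
    N (x - M ^ k *ᵥ x) ≤ k * N (x - M *ᵥ x) := by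
  induction k with
  | zero => simp
  | succ k ih =>
    have h1 : x - M ^ (k + 1) *ᵥ x = (x - M *ᵥ x) + M *ᵥ (x - M ^ k *ᵥ x) := by
      rw [Matrix.mulVec_sub, Matrix.mulVec_mulVec, ← pow_succ']
      abel
    rw [h1]
    calc _ ≤ N (x - M *ᵥ x) + N (M *ᵥ (x - M ^ k *ᵥ x)) := map_add_le_add N _ _
      _ ≤ N (x - M *ᵥ x) + k * N (x - M *ᵥ x) := by gcongr; exact (hN _).trans ih
      _ = _ := by push_cast; ring

/-- A resolvent bound at `1` which depends on the dimension and the spectral radius only. -/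
theorem pow_mul_seminorm_le {N : Seminorm ℝ (Fin d → ℝ)} {M : Matrix (Fin d) (Fin d) ℝ} {γ : ℝ}
    (hγ : γ ≤ 1) (hM : matSpectralRadius M ≤ γ) (hN : ∀ x, N (M *ᵥ x) ≤ N x) (x : Fin d → ℝ) :
    (1 - γ) ^ d * N x ≤ (2 ^ d * (d + 1) ^ 2) * N (x - M *ᵥ x) := by
  set χ := M.charpoly with hχ
  have hdeg : χ.natDegree = d := by simp [hχ]
  have hmap : χ.map (algebraMap ℝ ℂ) = (M.map (algebraMap ℝ ℂ)).charpoly :=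
    (Matrix.charpoly_map _ _).symm
  have hroots : ∀ z ∈ (χ.map (algebraMap ℝ ℂ)).roots, ‖z‖ ≤ γ := by
    intro z hz
    rw [hmap] at hz
    exact (norm_le_matSpectralRadius (isRoot_of_mem_roots hz)).trans hM
  -- The roots lie in the disc of radius `γ ≤ 1`: this bounds the coefficients of `χ` by binomials
  -- and `|χ(1)| = ∏ |1 - λ|` from below by `(1 - γ) ^ d`.
  have hsplit : (χ.map (algebraMap ℝ ℂ)).Splits := IsAlgClosed.splits _
  have hcoeff : ∀ i, |χ.coeff i| ≤ 2 ^ d := by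
    intro i
    have := coeff_le_of_roots_le i M.charpoly_monic hsplit (fun z hz => (hroots z hz).trans hγ)
    rw [← hχ, one_pow, one_mul, coeff_map, hdeg] at this
    have h2 : |χ.coeff i| ≤ d.choose i := by simpa using this
    refine h2.trans ?_
    exact_mod_cast Nat.choose_le_two_pow d i
  have hone : (1 - γ) ^ d ≤ |χ.eval 1| := by
    have h1 : (χ.map (algebraMap ℝ ℂ)).eval 1 =
        ((χ.map (algebraMap ℝ ℂ)).roots.map fun a => 1 - a).prod := by
      conv_lhs => rw [hsplit.eq_prod_roots]
      simp [eval_multiset_prod, (M.charpoly_monic.map (algebraMap ℝ ℂ)).leadingCoeff, hχ,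
        Multiset.map_map]
    have h2 : |χ.eval 1| = ‖(χ.map (algebraMap ℝ ℂ)).eval 1‖ := by
      rw [eval_map_algebraMap, ← map_one (algebraMap ℝ ℂ), aeval_algebraMap_apply]
      simp
    have hcard : Multiset.card (χ.map (algebraMap ℝ ℂ)).roots = d := by
      rw [← hsplit.natDegree_eq_card_roots, M.charpoly_monic.natDegree_map, ← hχ, hdeg]
    rw [h2, h1, ← hcard]
    have : ∀ s : Multiset ℂ, (∀ z ∈ s, ‖z‖ ≤ γ) →
        (1 - γ) ^ (Multiset.card s) ≤ ‖(s.map fun a => 1 - a).prod‖ := by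
      intro s
      induction s using Multiset.induction with
      | empty => simp
      | cons a s ih =>
        intro hs
        rw [Multiset.map_cons, Multiset.prod_cons, norm_mul, Multiset.card_cons, pow_succ']
        refine mul_le_mul ?_ (ih fun z hz => hs z (Multiset.mem_cons_of_mem hz))
          (pow_nonneg (by linarith) _) (norm_nonneg _)
        have := hs a (Multiset.mem_cons_self a s)
        have h3 := norm_sub_norm_le (1 : ℂ) a
        rw [norm_one] at h3
        linarith
    exact this _ hroots
  have hCH : (∑ i ∈ Finset.range (d + 1), χ.coeff i • M ^ i) = 0 := by
    have := M.aeval_self_charpoly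
    rw [← hχ, aeval_eq_sum_range, hdeg] at this
    exact this
  -- By Cayley–Hamilton the terms `χ.coeff i • M ^ i *ᵥ x` sum to zero, so subtracting them is free;
  -- each remaining difference telescopes into multiples of `N (x - M *ᵥ x)`.
  have heq : χ.eval 1 • x = ∑ i ∈ Finset.range (d + 1), χ.coeff i • (x - M ^ i *ᵥ x) := by
    simp only [smul_sub, Finset.sum_sub_distrib]
    have h1 : ∑ i ∈ Finset.range (d + 1), χ.coeff i • (M ^ i *ᵥ x) = 0 := by
      have := congrArg (· *ᵥ x) hCH
      simpa [Matrix.sum_mulVec, Matrix.smul_mulVec] using this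
    rw [h1, sub_zero, ← Finset.sum_smul, eval_eq_sum_range, hdeg]
    simp
  calc (1 - γ) ^ d * N x ≤ |χ.eval 1| * N x := by gcongr
    _ = N (χ.eval 1 • x) := by rw [map_smul_eq_mul, Real.norm_eq_abs]
    _ ≤ ∑ i ∈ Finset.range (d + 1), N (χ.coeff i • (x - M ^ i *ᵥ x)) := by
        rw [heq]; exact Finset.le_sum_of_subadditive _ (map_zero N).le (map_add_le_add N) _ _
    _ ≤ ∑ i ∈ Finset.range (d + 1), 2 ^ d * (d + 1) * N (x - M *ᵥ x) := by
        refine Finset.sum_le_sum fun i hi => ?_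
        rw [map_smul_eq_mul, Real.norm_eq_abs, mul_assoc]
        refine mul_le_mul (hcoeff i) ((seminorm_sub_pow_mulVec_le hN x i).trans ?_)
          (apply_nonneg _ _) (by positivity)
        gcongr
        have := Finset.mem_range.1 hi
        exact_mod_cast this.le
    _ = _ := by simp; ring

/-- A uniform gap: a contraction of a seminorm with spectral radius at most `γ < 1` moves every
vector away from itself and from its opposite. -/
theorem exists_seminorm_le_mul_sub (d : ℕ) {γ : ℝ} (hγ : γ < 1) :
    ∃ K : ℝ, 0 < K ∧ ∀ (N : Seminorm ℝ (Fin d → ℝ)) (M : Matrix (Fin d) (Fin d) ℝ),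
      matSpectralRadius M ≤ γ → (∀ x, N (M *ᵥ x) ≤ N x) → ∀ (s : ℝ), |s| = 1 → ∀ x,
        N x ≤ K * N (s • x - M *ᵥ x) := by
  have h1 : 0 < (1 - γ) ^ d := pow_pos (by linarith) _
  refine ⟨(2 ^ d * (d + 1) ^ 2) / (1 - γ) ^ d, by positivity, fun N M hM hN s hs x => ?_⟩
  have hss : s * s = 1 := by rw [← abs_mul_abs_self, hs, one_mul]
  have h2 := pow_mul_seminorm_le (N := N) (M := s • M) hγ.le
    (by rw [matSpectralRadius_smul, hs, one_mul]; exact hM)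
    (fun y => by rw [Matrix.smul_mulVec, map_smul_eq_mul, Real.norm_eq_abs, hs, one_mul]; exact hN y) x
  have h3 : x - (s • M) *ᵥ x = s • (s • x - M *ᵥ x) := by
    rw [smul_sub, smul_smul, hss, one_smul, Matrix.smul_mulVec]
  rw [h3, map_smul_eq_mul, Real.norm_eq_abs, hs, one_mul] at h2
  rw [div_mul_eq_mul_div, le_div_iff₀ h1]
  linarith

end Resolvent

/-! ### Products along words, infinite paths and compactness. -/

section Words

variable {d m : ℕ}

/-- The product of the matrices `B i` along a word. -/
def wordProd (B : Fin m → Matrix (Fin d) (Fin d) ℝ) (w : List (Fin m)) : Matrix (Fin d) (Fin d) ℝ :=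
  (w.map B).prod

@[simp]
theorem wordProd_nil (B : Fin m → Matrix (Fin d) (Fin d) ℝ) : wordProd B [] = 1 := rfl

theorem wordProd_cons (B : Fin m → Matrix (Fin d) (Fin d) ℝ) (i : Fin m) (w : List (Fin m)) :
    wordProd B (i :: w) = B i * wordProd B w := by
  simp [wordProd]

theorem wordProd_append (B : Fin m → Matrix (Fin d) (Fin d) ℝ) (u w : List (Fin m)) :
    wordProd B (u ++ w) = wordProd B u * wordProd B w := by
  simp [wordProd]

theorem wordProd_power (B : Fin m → Matrix (Fin d) (Fin d) ℝ) (w : List (Fin m)) (k : ℕ) :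
    wordProd B (List.replicate k w).flatten = wordProd B w ^ k := by
  induction k with
  | zero => simp
  | succ k ih => rw [List.replicate_succ, List.flatten_cons, wordProd_append, ih, pow_succ']

theorem wordProd_smul (t : ℝ) (B : Fin m → Matrix (Fin d) (Fin d) ℝ) (w : List (Fin m)) :
    wordProd (t • B) w = t ^ w.length • wordProd B w := by
  induction w with
  | nil => simp
  | cons i w ih =>
    rw [wordProd_cons, wordProd_cons, ih, Pi.smul_apply, Matrix.smul_mul, Matrix.mul_smul,
      smul_smul, List.length_cons, pow_succ']

theorem seminorm_wordProd_le {B : Fin m → Matrix (Fin d) (Fin d) ℝ}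
    {N : Seminorm ℝ (Fin d → ℝ)} (hN : ∀ i x, N (B i *ᵥ x) ≤ N x) (w : List (Fin m))
    (x : Fin d → ℝ) : N (wordProd B w *ᵥ x) ≤ N x := by
  induction w with
  | nil => simp
  | cons i w ih =>
    rw [wordProd_cons, ← Matrix.mulVec_mulVec]
    exact (hN _ _).trans ih

/-- The word read off an infinite sequence of letters, the first letter standing last. -/
def pathWord (j : ℕ → Fin m) : ℕ → List (Fin m)
  | 0 => []
  | n + 1 => j n :: pathWord j n

@[simp]
theorem length_pathWord (j : ℕ → Fin m) (n : ℕ) : (pathWord j n).length = n := by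
  induction n with
  | zero => rfl
  | succ n ih => simp [pathWord, ih]

theorem pathWord_suffix (j : ℕ → Fin m) {a b : ℕ} (h : a ≤ b) :
    pathWord j a <:+ pathWord j b := by
  induction b, h using Nat.le_induction with
  | base => exact List.suffix_rfl
  | succ b _ ih => exact ih.trans (List.suffix_cons _ _)

theorem eq_pathWord_of_suffix {j : ℕ → Fin m} {s : List (Fin m)} {b : ℕ}
    (h : s <:+ pathWord j b) : s = pathWord j s.length := by
  have hle : s.length ≤ b := by simpa using h.length_le
  exact (List.suffix_of_suffix_length_le h (pathWord_suffix j hle) (by simp)).eq_of_length (by simp)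

/-- König's lemma for words. -/
theorem exists_pathWord {Q : List (Fin m) → Prop} (hQ : ∀ u s, Q (u ++ s) → Q s)
    (h : ∀ n, ∃ s, s.length = n ∧ Q s) : ∃ j : ℕ → Fin m, ∀ n, Q (pathWord j n) := by
  -- `E s`: the node `s` has descendants in `Q` at every depth. With finitely many letters, some
  -- child inherits this.
  let E : List (Fin m) → Prop := fun s => ∀ n, ∃ u, u.length = n ∧ Q (u ++ s)
  have hE0 : E [] := fun n => by simpa using h n
  have hstep : ∀ s, E s → ∃ i, E (i :: s) := by
    intro s hs
    by_contra! hcon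
    simp only [E, not_forall, not_exists, not_and] at hcon
    choose n hn using hcon
    obtain ⟨u, hu, hQu⟩ := hs (Finset.univ.sup n + 1)
    obtain ⟨u', i, rfl⟩ : ∃ u' i, u = u' ++ [i] := by
      rcases List.eq_nil_or_concat u with rfl | ⟨u', i, rfl⟩
      · simp at hu
      · exact ⟨u', i, by simp⟩
    have hle : n i ≤ u'.length := by
      have h1 : n i ≤ Finset.univ.sup n := Finset.le_sup (Finset.mem_univ i)
      simp at hu
      omega
    refine hn i (u'.drop (u'.length - n i)) (by simp; omega) (hQ (u'.take (u'.length - n i)) _ ?_)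
    rw [← List.append_assoc, List.take_append_drop]
    simpa using hQu
  have hne : Nonempty (Fin m) := (hstep [] hE0).nonempty
  choose! nxt hnxt using hstep
  let st : ℕ → List (Fin m) := fun n => Nat.rec [] (fun _ s => nxt s :: s) n
  have hst : ∀ n, E (st n) := by
    intro n
    induction n with
    | zero => exact hE0
    | succ n ih => exact hnxt _ ih
  refine ⟨fun n => nxt (st n), fun n => ?_⟩
  have heq : ∀ n, pathWord (fun n => nxt (st n)) n = st n := by
    intro n
    induction n with
    | zero => rfl
    | succ n ih => simp only [pathWord, ih]; rfl
  obtain ⟨u, hu, hQu⟩ := hst n 0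
  rw [List.length_eq_zero_iff.1 hu] at hQu
  rw [heq]
  simpa using hQu

end Words

/-- A sequence bounded with respect to a seminorm of a finite-dimensional space has a subsequence
whose terms are pairwise close. -/
theorem Seminorm.exists_subseq_sub_lt {E : Type*} [AddCommGroup E] [Module ℝ E]
    [FiniteDimensional ℝ E] (N : Seminorm ℝ E) {x : ℕ → E} {C : ℝ} (hx : ∀ k, N (x k) ≤ C)
    {ε : ℝ} (hε : 0 < ε) :
    ∃ φ : ℕ → ℕ, StrictMono φ ∧ ∀ i j, N (x (φ i) - x (φ j)) < ε := by
  -- `N` may vanish on nonzero vectors; the separation quotient is a finite-dimensional normed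
  -- space, hence proper.
  let _ : SeminormedAddCommGroup E := N.toSeminormedAddCommGroup
  let _ : NormedSpace ℝ E := ⟨fun a b => (map_smul_eq_mul N a b).le⟩
  have hfin : FiniteDimensional ℝ (SeparationQuotient E) :=
    Module.Finite.of_surjective (SeparationQuotient.mkCLM ℝ E).toLinearMap
      SeparationQuotient.surjective_mk
  have hproper : ProperSpace (SeparationQuotient E) := FiniteDimensional.proper ℝ _
  have hmem : ∀ k, SeparationQuotient.mk (x k) ∈ Metric.closedBall (0 : SeparationQuotient E) C := by
    intro k
    rw [mem_closedBall_zero_iff, SeparationQuotient.norm_mk]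
    exact hx k
  obtain ⟨a, -, φ, hφ, hlim⟩ :=
    tendsto_subseq_of_bounded Metric.isBounded_closedBall hmem
  obtain ⟨K, hK⟩ := Metric.tendsto_atTop.1 hlim (ε / 2) (half_pos hε)
  refine ⟨fun i => φ (i + K), fun i j hij => hφ (by omega), fun i j => ?_⟩
  have h1 := hK (i + K) (by omega)
  have h2 := hK (j + K) (by omega)
  have h3 := dist_triangle_right (SeparationQuotient.mk (x (φ (i + K))))
    (SeparationQuotient.mk (x (φ (j + K)))) a
  have h4 : dist (SeparationQuotient.mk (x (φ (i + K)))) (SeparationQuotient.mk (x (φ (j + K)))) =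
      N (x (φ (i + K)) - x (φ (j + K))) := by
    rw [SeparationQuotient.dist_mk, dist_eq_norm]
    rfl
  rw [← h4]
  simp only [Function.comp_apply] at h1 h2
  linarith

/-! ### Bounded systems and the orbit norm. -/

section OrbitSeminorm

variable {d m : ℕ}

/-- All the products of the matrices `B i` are bounded by a common constant. -/
def IsBoundedSystem (B : Fin m → Matrix (Fin d) (Fin d) ℝ) : Prop :=
  ∃ C : ℝ, ∀ w x, ‖wordProd B w *ᵥ x‖ ≤ C * ‖x‖

/-- The supremum of the norms of the points of the orbit. -/
noncomputable def orbitSeminorm (B : Fin m → Matrix (Fin d) (Fin d) ℝ) : Seminorm ℝ (Fin d → ℝ) :=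
  ⨆ w : List (Fin m), (normSeminorm ℝ (Fin d → ℝ)).comp (wordProd B w).mulVecLin

variable {B : Fin m → Matrix (Fin d) (Fin d) ℝ}

theorem IsBoundedSystem.bddAbove (hB : IsBoundedSystem B) (x : Fin d → ℝ) :
    BddAbove (Set.range fun w => ‖wordProd B w *ᵥ x‖) := by
  obtain ⟨C, hC⟩ := hB
  exact ⟨C * ‖x‖, by rintro _ ⟨w, rfl⟩; exact hC w x⟩

/-- The supremum of a family of seminorms is computed pointwise only when the family is bounded;
otherwise it is a default value. -/
theorem IsBoundedSystem.orbitSeminorm_apply (hB : IsBoundedSystem B) (x : Fin d → ℝ) :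
    orbitSeminorm B x = ⨆ w, ‖wordProd B w *ᵥ x‖ := by
  rw [orbitSeminorm, Seminorm.iSup_apply]
  · rfl
  · rw [Seminorm.bddAbove_range_iff]
    exact hB.bddAbove

theorem IsBoundedSystem.norm_wordProd_le_orbitSeminorm (hB : IsBoundedSystem B)
    (w : List (Fin m)) (x : Fin d → ℝ) : ‖wordProd B w *ᵥ x‖ ≤ orbitSeminorm B x := by
  rw [hB.orbitSeminorm_apply]
  exact le_ciSup (hB.bddAbove x) w

theorem IsBoundedSystem.norm_le_orbitSeminorm (hB : IsBoundedSystem B) (x : Fin d → ℝ) :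
    ‖x‖ ≤ orbitSeminorm B x := by
  simpa using hB.norm_wordProd_le_orbitSeminorm [] x

theorem IsBoundedSystem.orbitSeminorm_mulVec_le (hB : IsBoundedSystem B) (i : Fin m)
    (x : Fin d → ℝ) : orbitSeminorm B (B i *ᵥ x) ≤ orbitSeminorm B x := by
  rw [hB.orbitSeminorm_apply]
  refine ciSup_le fun w => ?_
  have : wordProd B w *ᵥ (B i *ᵥ x) = wordProd B (w ++ [i]) *ᵥ x := by
    rw [wordProd_append, ← Matrix.mulVec_mulVec, wordProd_cons, wordProd_nil, mul_one]
  rw [this]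
  exact hB.norm_wordProd_le_orbitSeminorm _ _

theorem Seminorm.le_sum_abs_mul (N : Seminorm ℝ (Fin d → ℝ)) (x : Fin d → ℝ) :
    N x ≤ ∑ b, |x b| * N (Pi.single b 1) := by
  have hx : x = ∑ b, x b • (Pi.single b (1 : ℝ) : Fin d → ℝ) := by
    ext k
    simp [Finset.sum_apply, Pi.single_apply]
  conv_lhs => rw [hx]
  refine (Finset.le_sum_of_subadditive _ (map_zero N).le (map_add_le_add N) _ _).trans ?_
  refine Finset.sum_le_sum fun b _ => ?_
  rw [map_smul_eq_mul, Real.norm_eq_abs]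

theorem Seminorm.exists_le_mul_norm (N : Seminorm ℝ (Fin d → ℝ)) :
    ∃ C : ℝ, 0 < C ∧ ∀ x, N x ≤ C * ‖x‖ := by
  refine ⟨∑ b, N (Pi.single b 1) + 1,
    add_pos_of_nonneg_of_pos (Finset.sum_nonneg fun b _ => apply_nonneg _ _) one_pos, fun x => ?_⟩
  refine (N.le_sum_abs_mul x).trans ?_
  rw [add_mul, Finset.sum_mul]
  refine le_add_of_le_of_nonneg (Finset.sum_le_sum fun b _ => ?_) (by positivity)
  rw [mul_comm]
  exact mul_le_mul_of_nonneg_left (norm_le_pi_norm x b) (apply_nonneg _ _)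

/-- In contrapositive form: an unbounded system has arbitrarily large images of basis vectors. -/
theorem isBoundedSystem_of_basis {R : ℝ}
    (h : ∀ w b, ‖wordProd B w *ᵥ (Pi.single b (1 : ℝ) : Fin d → ℝ)‖ ≤ R) : IsBoundedSystem B := by
  refine ⟨∑ _b : Fin d, R, fun w x => ?_⟩
  refine (((normSeminorm ℝ (Fin d → ℝ)).comp (wordProd B w).mulVecLin).le_sum_abs_mul x).trans ?_
  rw [Finset.sum_mul]
  refine Finset.sum_le_sum fun b _ => ?_
  rw [mul_comm]
  exact mul_le_mul (h w b) (norm_le_pi_norm x b) (abs_nonneg _) ((norm_nonneg _).trans (h w b))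

end OrbitSeminorm

/-! ### Extremal seminorms; a uniform spectral bound below one implies boundedness. -/

section Extremal

variable {d m : ℕ}

/-- If a system is unbounded while all its contractions `t • B`, `t < 1`, are bounded, then it
contracts a nonzero seminorm for which every vector has arbitrarily long nondecreasing orbits;
these avoid returning to the vector. -/
theorem exists_extremal_seminorm {B : Fin m → Matrix (Fin d) (Fin d) ℝ}
    (hB : ∀ t : ℝ, 0 < t → t < 1 → IsBoundedSystem (t • B)) (hnb : ¬ IsBoundedSystem B) :
    ∃ N : Seminorm ℝ (Fin d → ℝ), (∃ b, 0 < N (Pi.single b 1)) ∧ (∀ i x, N (B i *ᵥ x) ≤ N x) ∧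
      ∀ v, 0 < N v → ∀ p : List (Fin m), p ≠ [] → ∀ n, ∃ s : List (Fin m), s.length = n ∧
        N v ≤ N (wordProd B s *ᵥ v) ∧
        ((wordProd B p *ᵥ v = v ∨ wordProd B p *ᵥ v = -v) → ¬ p <:+ s) := by
  set t : ℕ → ℝ := fun j => 1 - 1 / ((j : ℝ) + 2) with ht
  have hfrac : ∀ j : ℕ, 0 < 1 / ((j : ℝ) + 2) ∧ 1 / ((j : ℝ) + 2) ≤ 1 / 2 := fun j =>
    ⟨by positivity, one_div_le_one_div_of_le two_pos (by linarith [Nat.cast_nonneg (α := ℝ) j])⟩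
  have ht0 : ∀ j, 0 < t j := fun j => by linarith [(hfrac j).2]
  have hthalf : ∀ j, 1 / 2 ≤ t j := fun j => by linarith [(hfrac j).2]
  have ht1 : ∀ j, t j < 1 := fun j => by linarith [(hfrac j).1]
  have htlim : Tendsto t atTop (𝓝 1) := by
    have h1 : Tendsto (fun j : ℕ => 1 / ((j : ℝ) + 2)) atTop (𝓝 0) :=
      tendsto_const_nhds.div_atTop
        (tendsto_atTop_add_const_right _ _ tendsto_natCast_atTop_atTop)
    have h2 := h1.const_sub 1
    rwa [sub_zero] at h2
  have hbd : ∀ j, IsBoundedSystem (t j • B) := fun j => hB _ (ht0 j) (ht1 j)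
  set Q : ℕ → Seminorm ℝ (Fin d → ℝ) := fun j => orbitSeminorm (t j • B) with hQ
  set M : ℕ → ℝ := fun j => ∑ b, Q j (Pi.single b 1) with hM
  have hQle : ∀ j w x, t j ^ w.length * ‖wordProd B w *ᵥ x‖ ≤ Q j x := by
    intro j w x
    have := (hbd j).norm_wordProd_le_orbitSeminorm w x
    rwa [wordProd_smul, Matrix.smul_mulVec, norm_smul, Real.norm_eq_abs,
      abs_of_pos (pow_pos (ht0 j) _)] at this
  have hMtop : Tendsto M atTop atTop := by
    rw [tendsto_atTop]
    intro R
    obtain ⟨w, b, hwb⟩ : ∃ w b, R < ‖wordProd B w *ᵥ (Pi.single b (1 : ℝ) : Fin d → ℝ)‖ := by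
      by_contra! hcon
      exact hnb (isBoundedSystem_of_basis hcon)
    have hl : Tendsto (fun j => t j ^ w.length * ‖wordProd B w *ᵥ (Pi.single b (1 : ℝ) : Fin d → ℝ)‖)
        atTop (𝓝 (1 ^ w.length * ‖wordProd B w *ᵥ (Pi.single b (1 : ℝ) : Fin d → ℝ)‖)) :=
      (htlim.pow _).mul_const _
    rw [one_pow, one_mul] at hl
    filter_upwards [hl.eventually_const_lt hwb] with j hj
    refine hj.le.trans ((hQle j w _).trans ?_)
    exact Finset.single_le_sum (f := fun b => Q j (Pi.single b 1))
      (fun b _ => apply_nonneg _ _) (Finset.mem_univ b)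
  have hM0 : ∀ j, 0 ≤ M j := fun j => Finset.sum_nonneg fun b _ => apply_nonneg _ _
  have hratio : ∀ j x, Q j x / M j ≤ ∑ b, |x b| := by
    intro j x
    refine div_le_of_le_mul₀ (hM0 j) (Finset.sum_nonneg fun b _ => abs_nonneg _) ?_
    refine ((Q j).le_sum_abs_mul x).trans ?_
    rw [Finset.sum_mul]
    refine Finset.sum_le_sum fun b _ => mul_le_mul_of_nonneg_left ?_ (abs_nonneg _)
    exact Finset.single_le_sum (f := fun b => Q j (Pi.single b 1))
      (fun b _ => apply_nonneg _ _) (Finset.mem_univ b)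
  -- The rescaled orbit norms `Q j / M j` are pointwise bounded; an ultrafilter gives a limit at all
  -- vectors at once. The rescaling makes the limit sum to one over the basis, hence nonzero.
  set U : Ultrafilter ℕ := hyperfilter ℕ with hU
  have hUtop : (U : Filter ℕ) ≤ atTop := Nat.hyperfilter_le_atTop
  have hex : ∀ x, ∃ L, Tendsto (fun j => Q j x / M j) U (𝓝 L) := by
    intro x
    obtain ⟨L, -, hL⟩ := (isCompact_Icc (a := (0 : ℝ)) (b := ∑ b, |x b|)).ultrafilter_le_nhds'
      (U.map fun j => Q j x / M j)
      (Ultrafilter.mem_map.2 (Filter.univ_mem' fun j =>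
        ⟨div_nonneg (apply_nonneg _ _) (hM0 j), hratio j x⟩))
    exact ⟨L, hL⟩
  choose f hf using hex
  let N : Seminorm ℝ (Fin d → ℝ) := Seminorm.of f
    (fun x y => le_of_tendsto_of_tendsto' (hf (x + y)) ((hf x).add (hf y)) fun j => by
      rw [← add_div]
      exact div_le_div_of_nonneg_right (map_add_le_add (Q j) x y) (hM0 j))
    (fun a x => tendsto_nhds_unique (hf (a • x)) (((hf x).const_mul ‖a‖).congr fun j => by
      rw [map_smul_eq_mul, mul_div_assoc]))
  have hN : ∀ x, Tendsto (fun j => Q j x / M j) U (𝓝 (N x)) := hf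
  have htU : Tendsto t U (𝓝 1) := htlim.mono_left hUtop
  have hMU : Tendsto M U atTop := hMtop.mono_left hUtop
  refine ⟨N, ?_, ?_, ?_⟩
  · have hsum : ∑ b, N (Pi.single b 1) = 1 := by
      refine tendsto_nhds_unique (tendsto_finsetSum _ fun b _ => hN (Pi.single b 1)) ?_
      refine tendsto_const_nhds.congr' ?_
      filter_upwards [hMU.eventually_gt_atTop 0] with j hj
      rw [← Finset.sum_div, div_self hj.ne']
    by_contra! hcon
    have : ∑ b, N (Pi.single b 1) ≤ 0 := Finset.sum_nonpos fun b _ => hcon b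
    linarith
  · intro i x
    have h1 : Tendsto (fun j => t j * (Q j (B i *ᵥ x) / M j)) U (𝓝 (1 * N (B i *ᵥ x))) :=
      htU.mul (hN _)
    rw [one_mul] at h1
    refine le_of_tendsto_of_tendsto' h1 (hN x) fun j => ?_
    rw [← mul_div_assoc]
    refine div_le_div_of_nonneg_right ?_ (hM0 j)
    have := (hbd j).orbitSeminorm_mulVec_le i x
    rwa [Pi.smul_apply, Matrix.smul_mulVec, map_smul_eq_mul, Real.norm_eq_abs,
      abs_of_pos (ht0 j)] at this
  · intro v hv p hp n
    have hfinn : {s : List (Fin m) | s.length = n}.Finite := List.finite_length_eq _ n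
    have hfin : {s : List (Fin m) | s.length < n}.Finite := List.finite_length_lt _ n
    obtain ⟨C, hC⟩ : ∃ C, ∀ w : List (Fin m), w.length < n → ‖wordProd B w *ᵥ v‖ ≤ C := by
      obtain ⟨C, hC⟩ := (hfin.image fun w => ‖wordProd B w *ᵥ v‖).bddAbove
      exact ⟨C, fun w hw => hC ⟨w, hw, rfl⟩⟩
    have hQv : Tendsto (fun j => Q j v) U atTop := by
      have h1 : Tendsto (fun j => Q j v / M j * M j) U atTop := (hN v).pos_mul_atTop hv hMU
      refine h1.congr' ?_
      filter_upwards [hMU.eventually_gt_atTop 0] with j hj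
      rw [div_mul_cancel₀ _ hj.ne']
    -- A word `w` almost attaining `Q j v` is long because `Q j v → ∞`, and `s` consists of its `n`
    -- letters that act first. The slack `t j ^ p.length` is exactly what `w` would lose if it
    -- started with a run through `p`, which only returns to `± v`; so such words are ruled out.
    have hev : ∀ᶠ j in (U : Filter ℕ), ∃ s ∈ {s : List (Fin m) | s.length = n},
        t j ^ p.length * Q j v ≤ Q j (wordProd B s *ᵥ v) ∧
        ((wordProd B p *ᵥ v = v ∨ wordProd B p *ᵥ v = -v) → ¬ p <:+ s) := by
      filter_upwards [hQv.eventually_gt_atTop 0,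
        hQv.eventually_gt_atTop (C / (1 / 2) ^ p.length)] with j hj0 hjC
      have hlt : t j ^ p.length * Q j v < ⨆ w, ‖wordProd (t j • B) w *ᵥ v‖ := by
        rw [← (hbd j).orbitSeminorm_apply]
        refine mul_lt_of_lt_one_left hj0 (pow_lt_one₀ (ht0 j).le (ht1 j) ?_)
        simpa using hp
      obtain ⟨w, hw⟩ := exists_lt_of_lt_ciSup hlt
      rw [wordProd_smul, Matrix.smul_mulVec, norm_smul, Real.norm_eq_abs,
        abs_of_pos (pow_pos (ht0 j) _)] at hw
      have hwn : n ≤ w.length := by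
        by_contra! hwn
        have h1 := hC w hwn
        have h2 : C < (1 / 2) ^ p.length * Q j v := by
          rw [div_lt_iff₀ (by positivity)] at hjC
          linarith
        have h3 : (1 / 2) ^ p.length * Q j v ≤ t j ^ p.length * Q j v := by
          gcongr; exact hthalf j
        have h4 : t j ^ w.length * ‖wordProd B w *ᵥ v‖ ≤ ‖wordProd B w *ᵥ v‖ :=
          mul_le_of_le_one_left (norm_nonneg _) (pow_le_one₀ (ht0 j).le (ht1 j).le)
        linarith
      refine ⟨w.drop (w.length - n), by simp; omega, ?_, fun hpv hsuf => ?_⟩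
      · have h1 := hQle j (w.take (w.length - n)) (wordProd B (w.drop (w.length - n)) *ᵥ v)
        rw [Matrix.mulVec_mulVec, ← wordProd_append, List.take_append_drop] at h1
        refine hw.le.trans (le_trans ?_ h1)
        refine mul_le_mul_of_nonneg_right ?_ (norm_nonneg _)
        exact pow_le_pow_of_le_one (ht0 j).le (ht1 j).le (by simp)
      · obtain ⟨w', hw'⟩ := hsuf.trans (List.drop_suffix _ w)
        have h1 := hQle j w' v
        have h2 : ‖wordProd B w *ᵥ v‖ = ‖wordProd B w' *ᵥ v‖ := by
          rw [← hw', wordProd_append, ← Matrix.mulVec_mulVec]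
          rcases hpv with h | h
          · rw [h]
          · rw [h, Matrix.mulVec_neg, norm_neg]
        rw [h2, ← hw', List.length_append, pow_add, mul_comm (t j ^ w'.length), mul_assoc] at hw
        exact absurd hw (not_lt.2 (mul_le_mul_of_nonneg_left h1 (pow_pos (ht0 j) _).le))
    -- There are finitely many words of length `n`, so one of them serves for almost all `j`.
    rw [Ultrafilter.eventually_exists_mem_iff hfinn] at hev
    obtain ⟨s, hs, hev⟩ := hev
    refine ⟨s, hs, ?_, ?_⟩
    · have h1 : Tendsto (fun j => t j ^ p.length * (Q j v / M j)) U (𝓝 (1 ^ p.length * N v)) :=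
        (htU.pow _).mul (hN v)
      rw [one_pow, one_mul] at h1
      refine le_of_tendsto_of_tendsto h1 (hN (wordProd B s *ᵥ v)) ?_
      filter_upwards [hev] with j hj
      rw [← mul_div_assoc]
      exact div_le_div_of_nonneg_right hj.1 (hM0 j)
    · obtain ⟨j, hj⟩ := hev.exists
      exact hj.2

/-- A contractive seminorm decays uniformly along the words of a system whose products have
spectral radii at most `γ < 1`. -/
theorem exists_forall_length_seminorm_lt {B : Fin m → Matrix (Fin d) (Fin d) ℝ}
    {N : Seminorm ℝ (Fin d → ℝ)} (hN : ∀ i x, N (B i *ᵥ x) ≤ N x) {γ : ℝ} (hγ : γ < 1)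
    (hB : ∀ w : List (Fin m), w ≠ [] → matSpectralRadius (wordProd B w) ≤ γ) (x : Fin d → ℝ)
    {δ : ℝ} (hδ : 0 < δ) :
    ∃ n, ∀ s : List (Fin m), s.length = n → N (wordProd B s *ᵥ x) < δ := by
  by_contra! hcon
  -- Without uniform decay there is an infinite path on which `N` stays at least `δ`; two of its
  -- points closer than `δ / K` contradict the gap for the word between them.
  obtain ⟨j, hj⟩ := exists_pathWord (Q := fun s => δ ≤ N (wordProd B s *ᵥ x))
    (fun u s h => h.trans (by
      rw [wordProd_append, ← Matrix.mulVec_mulVec]; exact seminorm_wordProd_le hN _ _)) hcon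
  obtain ⟨K, hK0, hK⟩ := exists_seminorm_le_mul_sub d hγ
  obtain ⟨φ, hφ, hclose⟩ := N.exists_subseq_sub_lt (x := fun k => wordProd B (pathWord j k) *ᵥ x)
    (C := N x) (fun k => seminorm_wordProd_le hN _ _) (ε := δ / K) (by positivity)
  obtain ⟨u, hu⟩ := pathWord_suffix j (hφ (Nat.zero_lt_one)).le
  have hu0 : u ≠ [] := by
    rintro rfl
    have := congrArg List.length hu
    simp at this
    exact absurd (hφ.injective this) (by norm_num)
  have h1 := hK N (wordProd B u) (hB u hu0) (seminorm_wordProd_le hN u) 1 (by simp)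
    (wordProd B (pathWord j (φ 0)) *ᵥ x)
  rw [one_smul, Matrix.mulVec_mulVec, ← wordProd_append, hu] at h1
  have h2 := hclose 0 1
  rw [lt_div_iff₀ hK0] at h2
  have h3 := hj (φ 0)
  linarith

theorem IsBoundedSystem.smul_of_le {B : Fin m → Matrix (Fin d) (Fin d) ℝ} {s t : ℝ}
    (h : IsBoundedSystem (t • B)) (hs : 0 ≤ s) (hst : s ≤ t) : IsBoundedSystem (s • B) := by
  obtain ⟨C, hC⟩ := h
  refine ⟨C, fun w x => le_trans ?_ (hC w x)⟩
  rw [wordProd_smul, wordProd_smul, Matrix.smul_mulVec, Matrix.smul_mulVec, norm_smul, norm_smul]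
  refine mul_le_mul_of_nonneg_right ?_ (norm_nonneg _)
  rw [norm_pow, norm_pow, Real.norm_of_nonneg hs, Real.norm_of_nonneg (hs.trans hst)]
  exact pow_le_pow_left₀ hs hst _

/-- A system which contracts a norm by the factor `1 / 2` at some length stays bounded under a
slight dilation. -/
theorem IsBoundedSystem.exists_dilation {B : Fin m → Matrix (Fin d) (Fin d) ℝ}
    (hB : IsBoundedSystem B) {n : ℕ}
    (hn : ∀ s : List (Fin m), s.length = n → ∀ x,
      orbitSeminorm B (wordProd B s *ᵥ x) ≤ 1 / 2 * orbitSeminorm B x) :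
    ∃ r : ℝ, 1 < r ∧ IsBoundedSystem (r • B) := by
  -- For `n = 0` the hypothesis makes every vector zero.
  rcases Nat.eq_zero_or_pos n with rfl | hn0
  · refine ⟨2, one_lt_two, 0, fun w x => ?_⟩
    have h1 := hn [] rfl x
    rw [wordProd_nil, Matrix.one_mulVec] at h1
    have h2 := hB.norm_le_orbitSeminorm x
    have h3 : x = 0 := norm_le_zero_iff.1 (by linarith [norm_nonneg x])
    simp [h3]
  obtain ⟨r, hr1, hrn⟩ : ∃ r : ℝ, 1 < r ∧ r ^ n ≤ 2 := by
    -- The growth `r ^ n = 2` over a block of length `n` is cancelled by the contraction `1 / 2`.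
    refine ⟨(2 : ℝ) ^ ((n : ℝ)⁻¹), Real.one_lt_rpow one_lt_two (by positivity), ?_⟩
    rw [Real.rpow_inv_natCast_pow two_pos.le hn0.ne']
  have hr0 : 0 < r := one_pos.trans hr1
  obtain ⟨C, hC0, hC⟩ := (orbitSeminorm B).exists_le_mul_norm
  refine ⟨r, hr1, r ^ n * C, fun w => ?_⟩
  have key : ∀ k, ∀ w : List (Fin m), w.length < n * (k + 1) → ∀ x,
      r ^ w.length * orbitSeminorm B (wordProd B w *ᵥ x) ≤ r ^ n * orbitSeminorm B x := by
    intro k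
    induction k with
    | zero =>
      intro w hw x
      gcongr
      · exact hr1.le
      · omega
      · exact seminorm_wordProd_le hB.orbitSeminorm_mulVec_le w x
    | succ k ih =>
      intro w hw x
      rcases lt_or_ge w.length n with hlt | hge
      · gcongr
        · exact hr1.le
        · exact seminorm_wordProd_le hB.orbitSeminorm_mulVec_le w x
      · obtain ⟨u, s, rfl, hs⟩ : ∃ u s, w = u ++ s ∧ s.length = n :=
          ⟨w.take (w.length - n), w.drop (w.length - n), by simp, by simp; omega⟩
        have hu : u.length < n * (k + 1) := by
          rw [List.length_append, hs] at hw
          have : n * (k + 1 + 1) = n * (k + 1) + n := by ring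
          omega
        have h1 := ih u hu (wordProd B s *ᵥ x)
        rw [Matrix.mulVec_mulVec, ← wordProd_append] at h1
        have h2 := hn s hs x
        have h3 : r ^ n * orbitSeminorm B (wordProd B s *ᵥ x) ≤ orbitSeminorm B x := by
          have h4 : r ^ n * orbitSeminorm B (wordProd B s *ᵥ x) ≤
              2 * (1 / 2 * orbitSeminorm B x) :=
            mul_le_mul hrn h2 (apply_nonneg _ _) two_pos.le
          linarith
        rw [List.length_append, hs, pow_add, mul_comm (r ^ u.length), mul_assoc]
        gcongr
        linarith
  intro x
  rw [wordProd_smul, Matrix.smul_mulVec, norm_smul, norm_pow, Real.norm_of_nonneg hr0.le]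
  have h1 := key w.length w (by nlinarith) x
  have h2 := hB.norm_le_orbitSeminorm (wordProd B w *ᵥ x)
  calc _ ≤ r ^ w.length * orbitSeminorm B (wordProd B w *ᵥ x) := by gcongr
    _ ≤ r ^ n * orbitSeminorm B x := h1
    _ ≤ _ := by rw [mul_assoc]; gcongr; exact hC x

/-- A system whose products have spectral radii at most `γ < 1` is bounded. -/
theorem isBoundedSystem_of_matSpectralRadius_le {B : Fin m → Matrix (Fin d) (Fin d) ℝ} {γ : ℝ}
    (hγ : γ < 1) (hB : ∀ w : List (Fin m), w ≠ [] → matSpectralRadius (wordProd B w) ≤ γ) :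
    IsBoundedSystem B := by
  rcases isEmpty_or_nonempty (Fin m) with hm | ⟨⟨i₀⟩⟩
  · exact ⟨1, fun w x => by
      cases w with
      | nil => simp
      | cons i w => exact hm.elim i⟩
  have hscale : ∀ t : ℝ, 0 ≤ t → t ≤ 1 → ∀ w : List (Fin m), w ≠ [] →
      matSpectralRadius (wordProd (t • B) w) ≤ γ := by
    intro t ht0 ht1 w hw
    rw [wordProd_smul, matSpectralRadius_smul, abs_of_nonneg (pow_nonneg ht0 _)]
    exact (mul_le_of_le_one_left (matSpectralRadius_nonneg _) (pow_le_one₀ ht0 ht1)).trans (hB w hw)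
  -- Continuity argument in the scale: the supremum `τ` is attained, since an extremal seminorm at
  -- `τ` would contradict uniform decay; and `τ < 1` is impossible, since uniform decay allows a
  -- further dilation.
  set T : Set ℝ := {t | 0 ≤ t ∧ t ≤ 1 ∧ IsBoundedSystem (t • B)} with hT
  have hT0 : (0 : ℝ) ∈ T := by
    refine ⟨le_rfl, zero_le_one, 1, fun w x => ?_⟩
    rw [wordProd_smul, Matrix.smul_mulVec, norm_smul]
    cases w with
    | nil => simp
    | cons i w => simp
  have hTbdd : BddAbove T := ⟨1, fun t ht => ht.2.1⟩
  set τ := sSup T with hτ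
  have hτ0 : 0 ≤ τ := le_csSup hTbdd hT0
  have hτ1 : τ ≤ 1 := csSup_le ⟨0, hT0⟩ fun t ht => ht.2.1
  have hbelow : ∀ s, 0 ≤ s → s < τ → IsBoundedSystem (s • B) := by
    intro s hs0 hs
    obtain ⟨t, ht, hst⟩ := exists_lt_of_lt_csSup ⟨0, hT0⟩ hs
    exact ht.2.2.smul_of_le hs0 hst.le
  have hτB : IsBoundedSystem (τ • B) := by
    by_contra hnb
    have hτpos : 0 < τ := by
      rcases hτ0.eq_or_lt with h | h
      · rw [← h] at hnb; exact absurd hT0.2.2 hnb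
      · exact h
    obtain ⟨N, ⟨b, hb⟩, hN, hlong⟩ := exists_extremal_seminorm (B := τ • B) (fun t ht0 ht1 => by
      rw [smul_smul]
      exact hbelow _ (by positivity) (mul_lt_of_lt_one_left hτpos ht1)) hnb
    obtain ⟨n, hn⟩ := exists_forall_length_seminorm_lt hN hγ (hscale τ hτ0 hτ1)
      (Pi.single b 1) hb
    -- Any nonempty word does here, as the avoidance clause is discarded.
    obtain ⟨s, hs, hle, -⟩ := hlong _ hb [i₀] (by simp) n
    exact absurd (hn s hs) (not_lt.2 hle)
  rcases hτ1.eq_or_lt with h1 | h1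
  · rwa [h1, one_smul] at hτB
  exfalso
  set D := τ • B with hD
  set N := orbitSeminorm D with hN
  -- The threshold is chosen so that the sum over `d` basis vectors contracts by at least `1 / 2`.
  have hdecay : ∀ b : Fin d, ∃ n, ∀ s : List (Fin m), s.length = n →
      N (wordProd D s *ᵥ Pi.single b 1) < 1 / (2 * (d + 1)) := fun b =>
    exists_forall_length_seminorm_lt hτB.orbitSeminorm_mulVec_le hγ (hscale τ hτ0 hτ1) _
      (by positivity)
  choose n hn using hdecay
  have hn' : ∀ s : List (Fin m), s.length = Finset.univ.sup n → ∀ x,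
      N (wordProd D s *ᵥ x) ≤ 1 / 2 * N x := by
    intro s hs x
    refine ((N.comp (wordProd D s).mulVecLin).le_sum_abs_mul x).trans ?_
    have h2 : ∀ b, |x b| * N (wordProd D s *ᵥ Pi.single b 1) ≤ N x * (1 / (2 * (d + 1))) := by
      intro b
      refine mul_le_mul ((norm_le_pi_norm x b).trans (hτB.norm_le_orbitSeminorm x)) ?_
        (apply_nonneg _ _) (apply_nonneg _ _)
      have hle : n b ≤ s.length := hs ▸ Finset.le_sup (Finset.mem_univ b)
      have h3 : s = s.take (s.length - n b) ++ s.drop (s.length - n b) := by simp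
      rw [h3, wordProd_append, ← Matrix.mulVec_mulVec]
      exact (seminorm_wordProd_le hτB.orbitSeminorm_mulVec_le _ _).trans
        (hn b _ (by simp; omega)).le
    refine (Finset.sum_le_sum fun b _ => h2 b).trans ?_
    rw [Finset.sum_const, Finset.card_univ, Fintype.card_fin, nsmul_eq_mul]
    have h4 : (d : ℝ) * (1 / (2 * (d + 1))) ≤ 1 / 2 := by
      rw [mul_one_div, div_le_div_iff₀ (by positivity) two_pos]
      linarith
    nlinarith [apply_nonneg N x]
  obtain ⟨r, hr, hrB⟩ := hτB.exists_dilation hn'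
  rw [hD, smul_smul] at hrB
  -- For `τ = 0` dilating `τ` gains nothing; a small scale making every mode a contraction is used
  -- instead.
  rcases hτ0.eq_or_lt with h0 | h0
  · obtain ⟨C, hC0, hC⟩ : ∃ C : ℝ, 0 < C ∧ ∀ i x, ‖B i *ᵥ x‖ ≤ C * ‖x‖ := by
      choose C hC0 hC using fun i =>
        ((normSeminorm ℝ (Fin d → ℝ)).comp (B i).mulVecLin).exists_le_mul_norm
      refine ⟨∑ i, C i, Finset.sum_pos (fun i _ => hC0 i) ⟨i₀, Finset.mem_univ _⟩, fun i x => ?_⟩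
      refine (hC i x).trans (mul_le_mul_of_nonneg_right ?_ (norm_nonneg _))
      exact Finset.single_le_sum (fun i _ => (hC0 i).le) (Finset.mem_univ i)
    have hmem : min 1 C⁻¹ ∈ T := by
      refine ⟨by positivity, min_le_left _ _, 1, fun w x => ?_⟩
      rw [one_mul]
      refine seminorm_wordProd_le (N := normSeminorm ℝ (Fin d → ℝ)) (fun i y => ?_) w x
      rw [Pi.smul_apply, Matrix.smul_mulVec, coe_normSeminorm, norm_smul,
        Real.norm_of_nonneg (by positivity)]
      calc min 1 C⁻¹ * ‖B i *ᵥ y‖ ≤ C⁻¹ * (C * ‖y‖) := by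
            gcongr
            · exact min_le_right _ _
            · exact hC i y
        _ = ‖y‖ := by rw [inv_mul_cancel_left₀ hC0.ne']
    have := le_csSup hTbdd hmem
    have h2 : 0 < min 1 C⁻¹ := by positivity
    linarith
  · have hmem : min 1 (r * τ) ∈ T :=
      ⟨by positivity, min_le_left _ _, hrB.smul_of_le (by positivity) (min_le_right _ _)⟩
    have := le_csSup hTbdd hmem
    have h2 : τ < min 1 (r * τ) := lt_min h1 (lt_mul_of_one_lt_left h0 hr)
    linarith

end Extremal

/-! ### Periodicity of words and powers of a simple word. -/

section Combinatorics

variable {m : ℕ}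

theorem getElem?_flatten_replicate (u : List (Fin m)) (k : ℕ) {i : ℕ} (hi : i < k * u.length) :
    (List.replicate k u).flatten[i]? = u[i % u.length]? := by
  induction k generalizing i with
  | zero => simp at hi
  | succ k ih =>
    rw [List.replicate_succ, List.flatten_cons]
    rcases lt_or_ge i u.length with h | h
    · rw [List.getElem?_append_left h, Nat.mod_eq_of_lt h]
    · rw [List.getElem?_append_right h, ih (by rw [add_mul, one_mul] at hi; omega),
        ← Nat.mod_eq_sub_mod h]

theorem length_flatten_replicate (u : List (Fin m)) (k : ℕ) :
    (List.replicate k u).flatten.length = k * u.length := by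
  simp [List.length_flatten]

theorem IsSimpleWord.length_pos {p : List (Fin m)} (hp : IsSimpleWord p) : 0 < p.length :=
  List.length_pos_iff.2 hp.1

/-- By Bézout, a cyclic period `c` gives the cyclic period `g = gcd(c, |p|)`; then `p` is a power of
its first `g` letters, so simplicity forces `g = |p|`. -/
theorem IsSimpleWord.length_dvd {p : List (Fin m)} (hp : IsSimpleWord p) {c : ℕ}
    (h : ∀ i, p[(i + c) % p.length]? = p[i % p.length]?) : p.length ∣ c := by
  by_contra hdvd
  have hlt : Nat.gcd c p.length < p.length :=
    lt_of_le_of_ne (Nat.gcd_le_right _ hp.length_pos) fun he => hdvd (he ▸ Nat.gcd_dvd_left _ _)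
  obtain ⟨a, -, ha⟩ := Nat.exists_mul_mod_eq_gcd hlt
  set g := Nat.gcd c p.length with hg
  have hmul : ∀ b i, p[(i + c * b) % p.length]? = p[i % p.length]? := by
    intro b
    induction b with
    | zero => simp
    | succ b ih =>
      intro i
      rw [mul_add, mul_one, ← add_assoc, h, ih]
  have hgper : ∀ i, p[(i + g) % p.length]? = p[i % p.length]? := by
    intro i
    rw [← hmul a i, ← ha, Nat.add_mod_mod]
  have hgper' : ∀ b i, p[(i + g * b) % p.length]? = p[i % p.length]? := by
    intro b
    induction b with
    | zero => simp
    | succ b ih =>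
      intro i
      rw [mul_add, mul_one, ← add_assoc, hgper, ih]
  obtain ⟨k, hk⟩ : g ∣ p.length := Nat.gcd_dvd_right _ _
  have hg0 : 0 < g := Nat.gcd_pos_of_pos_right _ hp.length_pos
  have hlen : (p.take g).length = g := by simp [hlt.le]
  refine hp.2 (p.take g) k (by rw [hlen]; exact hlt) (List.ext_getElem? fun i => ?_)
  rcases lt_or_ge i p.length with hi | hi
  · rw [getElem?_flatten_replicate _ _ (by rw [hlen, mul_comm, ← hk]; exact hi), hlen,
      List.getElem?_take_of_lt (Nat.mod_lt _ hg0)]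
    have h1 := hgper' (i / g) (i % g)
    rw [Nat.mod_add_div, Nat.mod_eq_of_lt hi, Nat.mod_eq_of_lt ((Nat.mod_lt _ hg0).trans hlt)] at h1
    exact h1.symm
  · rw [List.getElem?_eq_none hi, List.getElem?_eq_none]
    rwa [length_flatten_replicate, hlen, mul_comm, ← hk]

theorem rotate_flatten_replicate (u : List (Fin m)) (k c : ℕ) :
    (List.replicate k u).flatten.rotate c = (List.replicate k (u.rotate c)).flatten := by
  refine List.ext_getElem? fun i => ?_
  rcases lt_or_ge i (k * u.length) with hi | hi
  · have hu : 0 < u.length := by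
      rcases Nat.eq_zero_or_pos u.length with h | h
      · simp [h] at hi
      · exact h
    rw [List.getElem?_rotate (by rwa [length_flatten_replicate]), length_flatten_replicate,
      getElem?_flatten_replicate _ _ (Nat.mod_lt _ (by omega)),
      getElem?_flatten_replicate _ _ (by rwa [List.length_rotate]), List.length_rotate,
      List.getElem?_rotate (Nat.mod_lt _ hu), Nat.mod_mul_left_mod, Nat.mod_add_mod]
  · rw [List.getElem?_eq_none (by rwa [List.length_rotate, length_flatten_replicate]),
      List.getElem?_eq_none (by rwa [length_flatten_replicate, List.length_rotate])]

/-- If a high power of `w` agrees with a power of the simple word `p` up to a prefix and a suffix,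
then `w` is a power of a cyclic permutation of `p`. -/
theorem IsSimpleWord.isPowerOfCyclicPerm {p w u u' : List (Fin m)} (hp : IsSimpleWord p)
    (hw : w ≠ []) {s j : ℕ} (hs : p.length + u'.length ≤ s)
    (h : (List.replicate s w).flatten ++ u = u' ++ (List.replicate j p).flatten) :
    IsPowerOfCyclicPerm p w := by
  have hw0 : 0 < w.length := List.length_pos_iff.2 hw
  have hlen := congrArg List.length h
  simp only [List.length_append, length_flatten_replicate] at hlen
  have hloc : ∀ k, k + u'.length < s * w.length →
      w[(k + u'.length) % w.length]? = p[k % p.length]? := by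
    intro k hk
    have h1 := congrArg (fun l : List (Fin m) => l[k + u'.length]?) h
    beta_reduce at h1
    rw [List.getElem?_append_left (by rwa [length_flatten_replicate]),
      List.getElem?_append_right (by omega), getElem?_flatten_replicate _ _ hk,
      getElem?_flatten_replicate _ _ (by omega), Nat.add_sub_cancel] at h1
    exact h1
  -- The overlap contains `|w| |p|` letters, a common period of both sides, so the local agreement
  -- extends to all indices.
  have hglob : ∀ k, w[(k + u'.length) % w.length]? = p[k % p.length]? := by
    intro k
    have hlt : k % (w.length * p.length) < w.length * p.length :=
      Nat.mod_lt _ (Nat.mul_pos hw0 hp.length_pos)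
    have hs' : w.length * p.length + u'.length ≤ s * w.length := by nlinarith
    have h1 := hloc (k % (w.length * p.length)) (by omega)
    rwa [Nat.mod_mul_left_mod, ← Nat.mod_add_mod, Nat.mod_mul_right_mod, Nat.mod_add_mod] at h1
  -- The left side of `hglob` has period `|w|`, hence so has the cyclic word `p`.
  obtain ⟨q, hq⟩ := hp.length_dvd (c := w.length) fun i => by
    rw [← hglob, ← hglob, add_right_comm, Nat.add_mod_right]
  have hrot : w.rotate u'.length = (List.replicate q p).flatten := by
    refine List.ext_getElem? fun i => ?_
    rcases lt_or_ge i w.length with hi | hi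
    · rw [List.getElem?_rotate hi, hglob, getElem?_flatten_replicate _ _ (by rwa [mul_comm, ← hq])]
    · rw [List.getElem?_eq_none (by rwa [List.length_rotate]),
        List.getElem?_eq_none (by rwa [length_flatten_replicate, mul_comm, ← hq])]
  obtain ⟨c, hc⟩ := (show w ~r (List.replicate q p).flatten from ⟨_, hrot⟩).symm
  rw [rotate_flatten_replicate] at hc
  exact ⟨p.rotate c, (List.IsRotated.symm ⟨c, rfl⟩), q, hc.symm⟩

theorem suffix_flatten_replicate (p : List (Fin m)) {k : ℕ} (hk : 0 < k) :
    p <:+ (List.replicate k p).flatten := by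
  obtain ⟨k, rfl⟩ := Nat.exists_eq_succ_of_ne_zero hk.ne'
  rw [Nat.succ_eq_add_one, List.replicate_succ', List.flatten_append]
  simp

/-- The overlap of the two powers makes `|u'|` a cyclic period of `p`, so `|p|` divides `|u'|` and
then `|u|`. A nonempty `u` would be at least as long as `p`, and comparing suffixes `p` would be a
suffix of `u`. -/
theorem IsSimpleWord.eq_nil_of_append_eq {p u u' : List (Fin m)} (hp : IsSimpleWord p)
    (hpu : ¬ p <:+ u) {n j : ℕ} (hn : u'.length + p.length ≤ n * p.length)
    (h : (List.replicate n p).flatten ++ u = u' ++ (List.replicate j p).flatten) : u = [] := by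
  have hlen := congrArg List.length h
  simp only [List.length_append, length_flatten_replicate] at hlen
  have hloc : ∀ k, k + u'.length < n * p.length →
      p[(k + u'.length) % p.length]? = p[k % p.length]? := by
    intro k hk
    have h1 := congrArg (fun l : List (Fin m) => l[k + u'.length]?) h
    beta_reduce at h1
    rw [List.getElem?_append_left (by rwa [length_flatten_replicate]),
      List.getElem?_append_right (by omega), getElem?_flatten_replicate _ _ hk,
      getElem?_flatten_replicate _ _ (by omega), Nat.add_sub_cancel] at h1
    exact h1
  have hdvd : p.length ∣ u'.length := hp.length_dvd fun i => by
    have hlt := Nat.mod_lt i hp.length_pos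
    have h1 := hloc (i % p.length) (by omega)
    rwa [Nat.mod_add_mod, Nat.mod_mod] at h1
  have hdvd2 : p.length ∣ u.length := by
    rw [← Nat.dvd_add_right (Dvd.intro_left n rfl), hlen]
    exact dvd_add hdvd (Dvd.intro_left j rfl)
  by_contra hu
  have hle := Nat.le_of_dvd (List.length_pos_iff.2 hu) hdvd2
  have hj : 0 < j := by
    rcases Nat.eq_zero_or_pos j with rfl | hj
    · have := hp.length_pos; omega
    · exact hj
  apply hpu
  refine List.suffix_of_suffix_length_le (l₃ := u' ++ (List.replicate j p).flatten) ?_ ?_ hle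
  · exact (suffix_flatten_replicate p hj).trans (List.suffix_append _ _)
  · rw [← h]; exact List.suffix_append _ _

theorem flatten_replicate_append_succ (x y : List (Fin m)) (k : ℕ) :
    (List.replicate (k + 1) (x ++ y)).flatten = x ++ (List.replicate k (y ++ x)).flatten ++ y := by
  induction k with
  | zero => simp
  | succ k ih =>
    rw [List.replicate_succ, List.flatten_cons, ih, List.replicate_succ, List.flatten_cons]
    simp

/-- If the segments of a path between infinitely many times are powers of cyclic permutations of
`p`, then the path is eventually periodic with period `p`. -/
theorem exists_flatten_replicate_append_suffix {p : List (Fin m)} (hp : p ≠ []) {j : ℕ → Fin m}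
    {φ : ℕ → ℕ} (hφ : StrictMono φ)
    (h : ∀ i u, 0 < i → u ++ pathWord j (φ 0) = pathWord j (φ i) → IsPowerOfCyclicPerm p u) :
    ∃ s : List (Fin m), ∀ n, ∃ b, (List.replicate n p).flatten ++ s <:+ pathWord j b := by
  have hp0 : 0 < p.length := List.length_pos_iff.2 hp
  have hex : ∀ i, 0 < i → ∃ q k, q ~r p ∧ i ≤ k * p.length ∧
      (List.replicate k q).flatten ++ pathWord j (φ 0) = pathWord j (φ i) := by
    intro i hi
    obtain ⟨u, hu⟩ := pathWord_suffix j (hφ.monotone (Nat.zero_le i))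
    obtain ⟨q, hq, k, rfl⟩ := h i u hi hu
    refine ⟨q, k, hq, ?_, hu⟩
    have hl := congrArg List.length hu
    rw [List.length_append, length_flatten_replicate, length_pathWord, length_pathWord,
      hq.perm.length_eq] at hl
    have h2 := hφ.add_le_nat i 0
    rw [add_zero] at h2
    omega
  obtain ⟨q, k₁, hq, hk₁, hq1⟩ := hex 1 one_pos
  have hk₁0 : 0 < k₁ := by
    rcases Nat.eq_zero_or_pos k₁ with rfl | h0
    · simp at hk₁
    · exact h0
  have hqsuf : q ++ pathWord j (φ 0) <:+ pathWord j (φ 1) := by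
    rw [← hq1]
    obtain ⟨z, hz⟩ := suffix_flatten_replicate q hk₁0
    exact ⟨z, by rw [← List.append_assoc, hz]⟩
  obtain ⟨c, hc, hrot⟩ := List.isRotated_iff_mod.1 hq
  rw [List.rotate_eq_drop_append_take hc] at hrot
  -- Write `q = x ++ y` with `p = y ++ x`. Since `(x y)^(k+1) = x (y x)^k y`, appending `y` to the
  -- initial piece realigns the period to `p`, at the cost of one period.
  refine ⟨q.drop c ++ pathWord j (φ 0), fun n => ?_⟩
  obtain ⟨q', k, hq', hk, hqi⟩ := hex ((n + 1) * p.length) (by positivity)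
  have hkn : n + 1 ≤ k := Nat.le_of_mul_le_mul_right hk hp0
  have hqsuf' : q' ++ pathWord j (φ 0) <:+ pathWord j (φ ((n + 1) * p.length)) := by
    rw [← hqi]
    obtain ⟨z, hz⟩ := suffix_flatten_replicate q' (show 0 < k by omega)
    exact ⟨z, by rw [← List.append_assoc, hz]⟩
  -- Both are the `|p|` letters of the path that follow time `φ 0`.
  have heq : q' = q := by
    have h1 := eq_pathWord_of_suffix hqsuf
    have h2 := eq_pathWord_of_suffix hqsuf'
    rw [List.length_append, hq.perm.length_eq] at h1
    rw [List.length_append, hq'.perm.length_eq, ← h1] at h2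
    exact List.append_cancel_right h2
  subst heq
  refine ⟨φ ((n + 1) * p.length), ?_⟩
  obtain ⟨r, rfl⟩ : ∃ r, k = r + n + 1 := ⟨k - (n + 1), by omega⟩
  rw [← hqi]
  conv_rhs => rw [← List.take_append_drop c q', flatten_replicate_append_succ, hrot,
    List.replicate_add, List.flatten_append]
  exact ⟨q'.take c ++ (List.replicate r p).flatten, by simp⟩

end Combinatorics

/-! ### Nondecaying paths that avoid `p`, and boundedness of dominant systems. -/

section Paths

variable {d m : ℕ}

/-- `M` and its deflation agree modulo the line of `v`, which `M` preserves. -/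
theorem exists_pow_mulVec_eq_deflation (M : Matrix (Fin d) (Fin d) ℝ) {v : Fin d → ℝ}
    (f : Fin d → ℝ) {c : ℝ} (hv : M *ᵥ v = c • v) (y : Fin d → ℝ) (n : ℕ) :
    ∃ l : ℝ, M ^ n *ᵥ y = (M - c • Matrix.vecMulVec v f) ^ n *ᵥ y + l • v := by
  induction n with
  | zero => exact ⟨0, by simp⟩
  | succ n ih =>
    obtain ⟨l, hl⟩ := ih
    set z := (M - c • Matrix.vecMulVec v f) ^ n *ᵥ y with hz
    refine ⟨c * (f ⬝ᵥ z) + l * c, ?_⟩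
    rw [pow_succ', ← Matrix.mulVec_mulVec, hl, pow_succ', ← Matrix.mulVec_mulVec, ← hz,
      Matrix.mulVec_add, Matrix.mulVec_smul, hv, Matrix.sub_mulVec, Matrix.smul_mulVec,
      Matrix.vecMulVec_mulVec]
    ext i
    simp
    ring

/-- A path which avoids `p` and does not decay visits neighbourhoods of multiples `l • v₀`, where
`|l|` stays away from `1`. -/
theorem exists_pathWord_near_smul {B : Fin m → Matrix (Fin d) (Fin d) ℝ} {p : List (Fin m)}
    (hp : IsSimpleWord p) {γ : ℝ} (hγ : γ < 1)
    (hdom : ∀ w, ¬ IsPowerOfCyclicPerm p w → matSpectralRadius (wordProd B w) ≤ γ)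
    {v₀ f : Fin d → ℝ} {c : ℝ} (hv : wordProd B p *ᵥ v₀ = c • v₀)
    (hdefl : matSpectralRadius (wordProd B p - c • Matrix.vecMulVec v₀ f) < 1)
    {N : Seminorm ℝ (Fin d → ℝ)} (hN : ∀ i x, N (B i *ᵥ x) ≤ N x) (hNv : 0 < N v₀)
    {j : ℕ → Fin m} {δ : ℝ} (hδ : 0 < δ) (hj : ∀ n, δ ≤ N (wordProd B (pathWord j n) *ᵥ v₀))
    (hjp : ∀ n, pathWord j n ≠ p) :
    ∃ η > 0, ∀ ε > 0, ∀ k₀, ∃ k ≥ k₀, ∃ l : ℝ, |l| ≤ 1 - η ∧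
      ‖wordProd B (pathWord j k) *ᵥ v₀ - l • v₀‖ ≤ ε := by
  obtain ⟨K, hK0, hK⟩ := exists_seminorm_le_mul_sub d hγ
  obtain ⟨φ, hφ, hclose⟩ := N.exists_subseq_sub_lt (x := fun k => wordProd B (pathWord j k) *ᵥ v₀)
    (C := N v₀) (fun k => seminorm_wordProd_le hN _ _) (ε := δ / K) (by positivity)
  have hseg : ∀ i u, 0 < i → u ++ pathWord j (φ 0) = pathWord j (φ i) →
      IsPowerOfCyclicPerm p u := by
    intro i u _ hu
    by_contra hnot
    have h1 := hK N (wordProd B u) (hdom u hnot) (seminorm_wordProd_le hN u) 1 (by simp)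
      (wordProd B (pathWord j (φ 0)) *ᵥ v₀)
    rw [one_smul, Matrix.mulVec_mulVec, ← wordProd_append, hu] at h1
    have h2 := hclose 0 i
    rw [lt_div_iff₀ hK0] at h2
    have h3 := hj (φ 0)
    linarith
  obtain ⟨s, hs⟩ := exists_flatten_replicate_append_suffix hp.1 hφ hseg
  set y := wordProd B s *ᵥ v₀ with hy
  choose l hl using exists_pow_mulVec_eq_deflation (wordProd B p) f hv y
  set D := wordProd B p - c • Matrix.vecMulVec v₀ f with hD
  have hD0 := tendsto_pow_mulVec_of_matSpectralRadius_lt_one hdefl y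
  obtain ⟨C, hC0, hC⟩ := N.exists_le_mul_norm
  have hND0 : Tendsto (fun n => N (D ^ n *ᵥ y)) atTop (𝓝 0) := by
    have h1 : Tendsto (fun n => C * ‖D ^ n *ᵥ y‖) atTop (𝓝 (C * ‖(0 : Fin d → ℝ)‖)) :=
      hD0.norm.const_mul C
    rw [norm_zero, mul_zero] at h1
    exact squeeze_zero (fun n => apply_nonneg _ _) (fun n => hC _) h1
  have hword : ∀ n, wordProd B ((List.replicate n p).flatten ++ s) *ᵥ v₀ =
      D ^ n *ᵥ y + l n • v₀ := by
    intro n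
    rw [wordProd_append, wordProd_power, ← Matrix.mulVec_mulVec, hl]
  -- If it were a power of `u`, comparing leading letters gives `u = p`; then the path would start
  -- with `p`.
  have hnotpow : ∀ n, 0 < n → ¬ IsPowerOfCyclicPerm p ((List.replicate n p).flatten ++ s) := by
    rintro n hn ⟨u, hu, k, hk⟩
    have hlen := hu.perm.length_eq
    have hk0 : 0 < k := by
      rcases Nat.eq_zero_or_pos k with rfl | h0
      · obtain ⟨n, rfl⟩ := Nat.exists_eq_succ_of_ne_zero hn.ne'
        rw [Nat.succ_eq_add_one, List.replicate_succ] at hk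
        have hp0 := hp.length_pos
        simp at hk
        simp [hk.1] at hp0
      · exact h0
    have hup : p = u := by
      obtain ⟨n, rfl⟩ := Nat.exists_eq_succ_of_ne_zero hn.ne'
      obtain ⟨k, rfl⟩ := Nat.exists_eq_succ_of_ne_zero hk0.ne'
      rw [Nat.succ_eq_add_one, List.replicate_succ, List.flatten_cons, Nat.succ_eq_add_one,
        List.replicate_succ, List.flatten_cons, List.append_assoc] at hk
      exact List.append_inj_left hk hlen.symm
    subst hup
    obtain ⟨b, hb⟩ := hs n
    rw [hk] at hb
    exact hjp _ (eq_pathWord_of_suffix ((suffix_flatten_replicate p hk0).trans hb)).symm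
  -- If `|l n|` exceeded `1 - 1 / (2 * K)`, contractivity would put it close to one, and `v₀` would
  -- be moved too little from `± v₀`; with an error below `N v₀ / (4 * K)` this contradicts the gap.
  refine ⟨1 / (2 * K), by positivity, fun ε hε k₀ => ?_⟩
  have he : 0 < N v₀ / (4 * K) := by positivity
  obtain ⟨n, hn1, hn2, hn0, hnk⟩ := ((hND0.eventually_lt_const he).and
    ((hD0.norm.eventually_lt_const (by rwa [norm_zero] : ‖(0 : Fin d → ℝ)‖ < ε)).and
    ((eventually_gt_atTop 0).and (eventually_ge_atTop k₀)))).exists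
  obtain ⟨b, hb⟩ := hs n
  have hpw := eq_pathWord_of_suffix hb
  refine ⟨((List.replicate n p).flatten ++ s).length, ?_, l n, ?_, ?_⟩
  · rw [List.length_append, length_flatten_replicate]
    have := hp.length_pos
    nlinarith
  · by_contra! hgt
    have hupper : |l n| * N v₀ ≤ N v₀ + N (D ^ n *ᵥ y) := by
      have h1 : l n • v₀ = wordProd B ((List.replicate n p).flatten ++ s) *ᵥ v₀ - D ^ n *ᵥ y := by
        rw [hword]; abel
      rw [← Real.norm_eq_abs, ← map_smul_eq_mul, h1]
      exact (map_sub_le_add N _ _).trans (add_le_add (seminorm_wordProd_le hN _ _) le_rfl)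
    -- `σ` is the sign of `l n`; this is why the gap is needed for both signs.
    obtain ⟨σ, hσ, hσl⟩ : ∃ σ : ℝ, |σ| = 1 ∧ |σ - l n| = |1 - (|l n|)| := by
      rcases le_total 0 (l n) with h | h
      · exact ⟨1, by simp, by rw [abs_of_nonneg h]⟩
      · refine ⟨-1, by simp, ?_⟩
        rw [abs_of_nonpos h, ← abs_neg]
        congr 1; ring
    have h1 := hK N _ (hdom _ (hnotpow n hn0)) (seminorm_wordProd_le hN _) σ hσ v₀
    have h2 : N (σ • v₀ - wordProd B ((List.replicate n p).flatten ++ s) *ᵥ v₀) ≤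
        |1 - (|l n|)| * N v₀ + N (D ^ n *ᵥ y) := by
      have h3 : σ • v₀ - wordProd B ((List.replicate n p).flatten ++ s) *ᵥ v₀ =
          (σ - l n) • v₀ - D ^ n *ᵥ y := by
        rw [hword, sub_smul]; abel
      rw [h3]
      refine (map_sub_le_add N _ _).trans (add_le_add ?_ le_rfl)
      rw [map_smul_eq_mul, Real.norm_eq_abs, hσl]
    have h4 : |1 - (|l n|)| * N v₀ ≤ max (1 / (2 * K) * N v₀) (N (D ^ n *ᵥ y)) := by
      rcases le_total 0 (1 - |l n|) with h | h
      · rw [abs_of_nonneg h]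
        exact (mul_le_mul_of_nonneg_right (by linarith) hNv.le).trans (le_max_left _ _)
      · rw [abs_of_nonpos h]
        refine le_trans ?_ (le_max_right _ _)
        linarith
    rw [lt_div_iff₀ (by positivity)] at hn1
    have h5 : N v₀ ≤ K * (max (1 / (2 * K) * N v₀) (N (D ^ n *ᵥ y)) + N (D ^ n *ᵥ y)) :=
      h1.trans (mul_le_mul_of_nonneg_left (h2.trans (by linarith)) hK0.le)
    rcases max_cases (1 / (2 * K) * N v₀) (N (D ^ n *ᵥ y)) with ⟨h, -⟩ | ⟨h, -⟩
    · rw [h, mul_add] at h5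
      have h6 : K * (1 / (2 * K) * N v₀) = N v₀ / 2 := by field_simp
      linarith
    · rw [h] at h5
      linarith
  · rw [← hpw, hword, add_sub_cancel_right]
    exact hn2.le

/-- A dominant product with a unique and simple leading eigenvalue whose leading eigenvector is
cyclic has a bounded system. -/
theorem isBoundedSystem_of_dominant {B : Fin m → Matrix (Fin d) (Fin d) ℝ} {p : List (Fin m)}
    (hp : IsSimpleWord p) {γ : ℝ} (hγ : γ < 1)
    (hdom : ∀ w, ¬ IsPowerOfCyclicPerm p w → matSpectralRadius (wordProd B w) ≤ γ)
    (hpone : matSpectralRadius (wordProd B p) ≤ 1)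
    {v₀ f : Fin d → ℝ} {c : ℝ} (hc : |c| = 1) (hv : wordProd B p *ᵥ v₀ = c • v₀)
    (hdefl : matSpectralRadius (wordProd B p - c • Matrix.vecMulVec v₀ f) < 1)
    (hcyc : ∀ W : Submodule ℝ (Fin d → ℝ), (∀ i, ∀ x ∈ W, B i *ᵥ x ∈ W) → v₀ ∈ W → W = ⊤) :
    IsBoundedSystem B := by
  by_contra hnb
  have hone : ∀ w, matSpectralRadius (wordProd B w) ≤ 1 := by
    intro w
    by_cases hw : IsPowerOfCyclicPerm p w
    · obtain ⟨u, hu, k, rfl⟩ := hw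
      rw [wordProd_power]
      apply matSpectralRadius_pow_le
      obtain ⟨n, hn, hrot⟩ := List.isRotated_iff_mod.1 hu
      rw [List.rotate_eq_drop_append_take hn] at hrot
      rw [← hrot, wordProd_append, matSpectralRadius_mul_comm, ← wordProd_append,
        List.take_append_drop] at hpone
      exact hpone
    · exact (hdom w hw).trans hγ.le
  obtain ⟨N, ⟨b, hb⟩, hN, hlong⟩ := exists_extremal_seminorm (B := B) (fun t ht0 ht1 => by
    refine isBoundedSystem_of_matSpectralRadius_le ht1 fun w hw => ?_
    rw [wordProd_smul, matSpectralRadius_smul, abs_of_pos (pow_pos ht0 _)]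
    calc t ^ w.length * matSpectralRadius (wordProd B w) ≤ t ^ 1 * 1 := by
          refine mul_le_mul (pow_le_pow_of_le_one ht0.le ht1.le ?_) (hone w)
            (matSpectralRadius_nonneg _) (by positivity)
          exact List.length_pos_iff.2 hw
      _ = t := by ring) hnb
  have hNv : 0 < N v₀ := by
    by_contra! h0
    -- The kernel of `N` is invariant; if it contained the cyclic vector `v₀`, then `N` would
    -- vanish.
    let W : Submodule ℝ (Fin d → ℝ) :=
      { carrier := {x | N x ≤ 0}
        add_mem' := fun {x y} hx hy =>
          (map_add_le_add N x y).trans (add_nonpos (Set.mem_ofPred.1 hx) (Set.mem_ofPred.1 hy))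
        zero_mem' := (map_zero N).le
        smul_mem' := fun a x hx => by
          rw [Set.mem_ofPred, map_smul_eq_mul]
          exact mul_nonpos_of_nonneg_of_nonpos (norm_nonneg _) hx }
    have hW := hcyc W (fun i x hx => (hN i x).trans hx) h0
    have : Pi.single b (1 : ℝ) ∈ W := hW ▸ Submodule.mem_top
    exact absurd hb (not_lt.2 this)
  have hcv : wordProd B p *ᵥ v₀ = v₀ ∨ wordProd B p *ᵥ v₀ = -v₀ := by
    rcases eq_or_eq_neg_of_abs_eq hc with h | h
    · exact Or.inl (by rw [hv, h, one_smul])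
    · exact Or.inr (by rw [hv, h, neg_one_smul])
  obtain ⟨j, hj⟩ := exists_pathWord
    (Q := fun s => N v₀ ≤ N (wordProd B s *ᵥ v₀) ∧ ¬ p <:+ s)
    (fun u s h => ⟨h.1.trans (by
      rw [wordProd_append, ← Matrix.mulVec_mulVec]; exact seminorm_wordProd_le hN _ _),
      fun hps => h.2 (hps.trans (List.suffix_append _ _))⟩)
    (fun n => by
      obtain ⟨s, hs, h1, h2⟩ := hlong v₀ hNv p hp.1 n
      exact ⟨s, hs, h1, h2 hcv⟩)
  obtain ⟨η, hη, hnear⟩ := exists_pathWord_near_smul hp hγ hdom hv hdefl hN hNv hNv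
    (fun n => (hj n).1) (fun n hn => (hj n).2 (hn ▸ List.suffix_rfl))
  obtain ⟨C, hC0, hC⟩ := N.exists_le_mul_norm
  -- The error costs at most `η * N v₀ / 2` in `N`, so the path drops to `(1 - η / 2) * N v₀`, below
  -- its lower bound.
  obtain ⟨k, -, l, hl, hkl⟩ := hnear (η * N v₀ / (2 * C)) (by positivity) 0
  have h1 := (hj k).1
  have h2 : N (wordProd B (pathWord j k) *ᵥ v₀) ≤
      N (wordProd B (pathWord j k) *ᵥ v₀ - l • v₀) + N (l • v₀) := by
    simpa using map_add_le_add N (wordProd B (pathWord j k) *ᵥ v₀ - l • v₀) (l • v₀)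
  have h3 : N (l • v₀) ≤ (1 - η) * N v₀ := by
    rw [map_smul_eq_mul]
    exact mul_le_mul_of_nonneg_right hl hNv.le
  have h4 : N (wordProd B (pathWord j k) *ᵥ v₀ - l • v₀) ≤ C * (η * N v₀ / (2 * C)) :=
    (hC _).trans (by gcongr)
  have h5 : C * (η * N v₀ / (2 * C)) = η * N v₀ / 2 := by field_simp
  nlinarith [mul_pos hη hNv]

end Paths

/-! ### Absolutely convex hulls of spanning sets. -/

section Hull

variable {d : ℕ}

theorem absConvexHull_subset_span (s : Set (Fin d → ℝ)) :
    absConvexHull ℝ s ⊆ (Submodule.span ℝ s : Set (Fin d → ℝ)) := by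
  refine absConvexHull_min Submodule.subset_span ⟨?_, (Submodule.span ℝ s).convex⟩
  rintro a - _ ⟨x, hx, rfl⟩
  exact (Submodule.span ℝ s).smul_mem a hx

theorem neg_mem_absConvexHull {s : Set (Fin d → ℝ)} {x : Fin d → ℝ}
    (hx : x ∈ absConvexHull ℝ s) : -x ∈ absConvexHull ℝ s :=
  balanced_absConvexHull.neg_mem_iff.2 hx

/-- The hull spans, so it has an interior point `x`; by symmetry `-x` is interior, and so is the
midpoint `0`. -/
theorem absConvexHull_mem_nhds_zero {s : Set (Fin d → ℝ)} (hs : Submodule.span ℝ s = ⊤)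
    (hne : s.Nonempty) : absConvexHull ℝ s ∈ 𝓝 (0 : Fin d → ℝ) := by
  set P := absConvexHull ℝ s with hP
  have hconv : Convex ℝ P := convex_absConvexHull
  have h0 : (0 : Fin d → ℝ) ∈ P :=
    balanced_absConvexHull.zero_mem (absConvexHull_nonempty.2 hne)
  have hspan : affineSpan ℝ P = ⊤ := by
    have h1 : insert (0 : Fin d → ℝ) P = P := Set.insert_eq_of_mem h0
    rw [← h1]
    apply SetLike.coe_injective
    rw [affineSpan_insert_zero]
    have : Submodule.span ℝ P = ⊤ :=
      top_le_iff.1 (hs ▸ Submodule.span_mono subset_absConvexHull)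
    rw [this]; rfl
  obtain ⟨x, hx⟩ := hconv.interior_nonempty_iff_affineSpan_eq_top.2 hspan
  have hx' : -x ∈ interior P := by
    have h1 : -P = P := by
      ext y
      rw [Set.mem_neg]
      exact ⟨fun h => by simpa using neg_mem_absConvexHull h, neg_mem_absConvexHull⟩
    have h2 : interior (-P) = -interior P := (Homeomorph.neg (Fin d → ℝ)).preimage_interior P |>.symm
    rw [← Set.neg_mem_neg, ← h2, h1, neg_neg] at *
    simpa using hx
  rw [← mem_interior_iff_mem_nhds]
  have := hconv.interior hx hx' (show (0 : ℝ) ≤ 1 / 2 by norm_num) (show (0 : ℝ) ≤ 1 / 2 by norm_num)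
    (by norm_num)
  simpa using this

end Hull

/-! ### Invariants of the runs of the algorithm. -/

namespace WeightedSystem

variable {d m : ℕ} (S : WeightedSystem d m) (p : List (Fin m)) (v₀ : Fin d → ℝ)

theorem ipaVector_append (u w : List (Fin m)) :
    S.ipaVector p v₀ (u ++ w) = wordProd (S.normalized p).A u *ᵥ S.ipaVector p v₀ w := by
  rw [ipaVector, ipaVector, Matrix.mulVec_mulVec]
  exact congrArg (· *ᵥ v₀) (wordProd_append (S.normalized p).A u w)

theorem ipaVector_cons (i : Fin m) (w : List (Fin m)) :
    S.ipaVector p v₀ (i :: w) = (S.normalized p).A i *ᵥ S.ipaVector p v₀ w := by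
  have := S.ipaVector_append p v₀ [i] w
  rwa [wordProd_cons, wordProd_nil, mul_one] at this

@[simp]
theorem ipaVector_nil : S.ipaVector p v₀ [] = v₀ := by
  simp [ipaVector, product]

/-- Removes the order of visits: each node is tested against an intermediate hull, lying between the
initial and the final one, so skipped nodes are interior to the final hull and added nodes are not
interior to the initial one. -/
theorem foldl_ipaVisit_spec (L : List (List (Fin m))) (st : IPAState d m) :
    let res := L.foldl (S.ipaVisit p v₀) st
    st.V ⊆ res.V ∧ (∀ w ∈ st.R, w ∈ res.R) ∧
    (∀ w ∈ L, w = p ∨ S.ipaVector p v₀ w ∈ interior (absConvexHull ℝ res.V) ∨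
      (w ∈ res.R ∧ S.ipaVector p v₀ w ∈ res.V)) ∧
    (∀ w ∈ res.R, w ∈ st.R ∨ (w ∈ L ∧ w ≠ p ∧
      S.ipaVector p v₀ w ∉ interior (absConvexHull ℝ st.V) ∧ S.ipaVector p v₀ w ∈ res.V)) ∧
    (∀ x ∈ res.V, x ∈ st.V ∨ ∃ w ∈ res.R, x = S.ipaVector p v₀ w) := by
  induction L generalizing st with
  | nil =>
    exact ⟨subset_rfl, fun _ h => h, by simp, fun _ h => Or.inl h, fun _ h => Or.inl h⟩
  | cons a L ih =>
    intro res
    obtain ⟨h1, h2, h3, h4, h5⟩ := ih (S.ipaVisit p v₀ st a)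
    change (S.ipaVisit p v₀ st a).V ⊆ res.V at h1
    change ∀ w ∈ (S.ipaVisit p v₀ st a).R, w ∈ res.R at h2
    change ∀ w ∈ L, w = p ∨ S.ipaVector p v₀ w ∈ interior (absConvexHull ℝ res.V) ∨
      (w ∈ res.R ∧ S.ipaVector p v₀ w ∈ res.V) at h3
    change ∀ w ∈ res.R, _ ∨ (w ∈ L ∧ w ≠ p ∧ _ ∧ S.ipaVector p v₀ w ∈ res.V) at h4
    change ∀ x ∈ res.V, _ ∨ ∃ w ∈ res.R, x = S.ipaVector p v₀ w at h5
    by_cases hc : a = p ∨ S.ipaVector p v₀ a ∈ interior (absConvexHull ℝ st.V)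
    · have hst : S.ipaVisit p v₀ st a = st := by rw [ipaVisit, if_pos hc]
      rw [hst] at h1 h2 h4 h5
      refine ⟨h1, h2, ?_, fun w hw => ?_, h5⟩
      · intro w hw
        rcases List.mem_cons.1 hw with rfl | hw
        · rcases hc with hc | hc
          · exact Or.inl hc
          · exact Or.inr (Or.inl (interior_mono ((absConvexHull ℝ).monotone h1) hc))
        · exact h3 w hw
      · rcases h4 w hw with h | ⟨h, h'⟩
        · exact Or.inl h
        · exact Or.inr ⟨List.mem_cons_of_mem _ h, h'⟩
    · have hst : S.ipaVisit p v₀ st a = ⟨insert (S.ipaVector p v₀ a) st.V, st.R ++ [a]⟩ := by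
        rw [ipaVisit, if_neg hc]
      rw [hst] at h1 h2 h4 h5
      push Not at hc
      have hsub : st.V ⊆ res.V := (Set.subset_insert _ _).trans h1
      have haV : S.ipaVector p v₀ a ∈ res.V := h1 (Set.mem_insert _ _)
      have haR : a ∈ res.R := h2 a (by simp)
      refine ⟨hsub, fun w hw => h2 w (by simp [hw]), ?_, fun w hw => ?_, fun x hx => ?_⟩
      · intro w hw
        rcases List.mem_cons.1 hw with rfl | hw
        · exact Or.inr (Or.inr ⟨haR, haV⟩)
        · exact h3 w hw
      · rcases h4 w hw with h | ⟨h, h', h'', h'''⟩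
        · rcases List.mem_append.1 h with h | h
          · exact Or.inl h
          · rw [List.mem_singleton] at h
            subst h
            exact Or.inr ⟨by simp, hc.1, hc.2, haV⟩
        · exact Or.inr ⟨List.mem_cons_of_mem _ h, h', fun hin => h''
            (interior_mono ((absConvexHull ℝ).monotone (Set.subset_insert _ _)) hin), h'''⟩
      · rcases h5 x hx with h | h
        · rcases h with rfl | h
          · exact Or.inr ⟨a, haR, rfl⟩
          · exact Or.inl h
        · exact Or.inr h

theorem ipaRun_succ (k : ℕ) :
    S.ipaRun p v₀ (k + 1) = S.ipaIterate p v₀ (S.ipaRun p v₀ k) :=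
  Function.iterate_succ_apply' _ _ _

theorem ipaRun_V_subset_succ (k : ℕ) : (S.ipaRun p v₀ k).V ⊆ (S.ipaRun p v₀ (k + 1)).V := by
  rw [ipaRun_succ]
  exact (S.foldl_ipaVisit_spec p v₀ _ ⟨(S.ipaRun p v₀ k).V, []⟩).1

theorem ipaRun_V_monotone : Monotone fun k => (S.ipaRun p v₀ k).V :=
  monotone_nat_of_le_succ (S.ipaRun_V_subset_succ p v₀)

variable {S p v₀}

theorem ipaRun_child {k : ℕ} {w : List (Fin m)} (hw : w ∈ (S.ipaRun p v₀ k).R) (i : Fin m) :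
    i :: w = p ∨
    S.ipaVector p v₀ (i :: w) ∈ interior (absConvexHull ℝ (S.ipaRun p v₀ (k + 1)).V) ∨
    (i :: w ∈ (S.ipaRun p v₀ (k + 1)).R ∧
      S.ipaVector p v₀ (i :: w) ∈ (S.ipaRun p v₀ (k + 1)).V) := by
  rw [ipaRun_succ]
  refine (S.foldl_ipaVisit_spec p v₀ _ ⟨(S.ipaRun p v₀ k).V, []⟩).2.2.1 (i :: w) ?_
  rw [List.mem_flatMap]
  exact ⟨w, hw, by simp⟩

theorem exists_of_mem_ipaRun_succ {k : ℕ} {w : List (Fin m)}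
    (hw : w ∈ (S.ipaRun p v₀ (k + 1)).R) :
    (∃ i, ∃ w' ∈ (S.ipaRun p v₀ k).R, w = i :: w') ∧ w ≠ p ∧
    S.ipaVector p v₀ w ∉ interior (absConvexHull ℝ (S.ipaRun p v₀ k).V) ∧
    S.ipaVector p v₀ w ∈ (S.ipaRun p v₀ (k + 1)).V := by
  rw [ipaRun_succ] at hw ⊢
  rcases (S.foldl_ipaVisit_spec p v₀ _ ⟨(S.ipaRun p v₀ k).V, []⟩).2.2.2.1 w hw with h | ⟨h, h'⟩
  · simp at h
  · refine ⟨?_, h'⟩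
    rw [List.mem_flatMap] at h
    obtain ⟨w', hw', h⟩ := h
    rw [List.mem_map] at h
    obtain ⟨i, -, rfl⟩ := h
    exact ⟨i, w', hw', rfl⟩

theorem nil_mem_ipaRun_zero : [] ∈ (S.ipaRun p v₀ 0).R := by
  simp [ipaRun]

theorem ipaVector_mem_ipaRun {k : ℕ} {w : List (Fin m)} (hw : w ∈ (S.ipaRun p v₀ k).R) :
    S.ipaVector p v₀ w ∈ (S.ipaRun p v₀ k).V := by
  cases k with
  | zero =>
    have : w = [] := by simpa [ipaRun] using hw
    subst this
    simp [ipaRun]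
  | succ k => exact (exists_of_mem_ipaRun_succ hw).2.2.2

theorem length_of_mem_ipaRun {k : ℕ} {w : List (Fin m)} (hw : w ∈ (S.ipaRun p v₀ k).R) :
    w.length = k := by
  induction k generalizing w with
  | zero =>
    have : w = [] := by simpa [ipaRun] using hw
    simp [this]
  | succ k ih =>
    obtain ⟨⟨i, w', hw', rfl⟩, -⟩ := exists_of_mem_ipaRun_succ hw
    simp [ih hw']

theorem ne_of_mem_ipaRun (hp : p ≠ []) {k : ℕ} {w : List (Fin m)}
    (hw : w ∈ (S.ipaRun p v₀ k).R) : w ≠ p := by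
  cases k with
  | zero =>
    have : w = [] := by simpa [ipaRun] using hw
    rw [this]; exact hp.symm
  | succ k => exact (exists_of_mem_ipaRun_succ hw).2.1

/-- Ancestors of added nodes were added, which is the closure property required by König's lemma. -/
theorem mem_ipaRun_of_append {u s : List (Fin m)}
    (h : u ++ s ∈ (S.ipaRun p v₀ (u ++ s).length).R) : s ∈ (S.ipaRun p v₀ s.length).R := by
  induction u with
  | nil => exact h
  | cons i u ih =>
    apply ih
    obtain ⟨⟨i', w', hw', he⟩, -⟩ := exists_of_mem_ipaRun_succ h
    injection he with he1 he2
    rw [← he2] at hw'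
    exact hw'

theorem exists_of_mem_ipaRun_V {k : ℕ} {x : Fin d → ℝ} (hx : x ∈ (S.ipaRun p v₀ k).V) :
    ∃ l ≤ k, ∃ w ∈ (S.ipaRun p v₀ l).R, x = S.ipaVector p v₀ w := by
  induction k with
  | zero =>
    have : x = v₀ := by simpa [ipaRun] using hx
    exact ⟨0, le_rfl, [], nil_mem_ipaRun_zero, by simp [this]⟩
  | succ k ih =>
    have hx' := hx
    rw [ipaRun_succ] at hx'
    rcases (S.foldl_ipaVisit_spec p v₀ _ ⟨(S.ipaRun p v₀ k).V, []⟩).2.2.2.2 x hx' with h | ⟨w, hw, h⟩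
    · obtain ⟨l, hl, w, hw, h⟩ := ih h
      exact ⟨l, by omega, w, hw, h⟩
    · refine ⟨k + 1, le_rfl, w, ?_, h⟩
      rw [ipaRun_succ]
      exact hw

theorem initial_mem_ipaRun_V (k : ℕ) : v₀ ∈ (S.ipaRun p v₀ k).V :=
  S.ipaRun_V_monotone p v₀ (Nat.zero_le k) (by simp [ipaRun])

/-- After finitely many iterations the absolutely convex hull is a neighbourhood of the origin. -/
theorem exists_absConvexHull_ipaRun_mem_nhds {c : ℝ}
    (hv : (S.normalized p).product p *ᵥ v₀ = c • v₀)
    (hcyc : (S.normalized p).IsCyclicVector v₀) :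
    ∃ k₀, ∀ k ≥ k₀, absConvexHull ℝ (S.ipaRun p v₀ k).V ∈ 𝓝 (0 : Fin d → ℝ) := by
  set V : ℕ → Set (Fin d → ℝ) := fun k => (S.ipaRun p v₀ k).V with hV
  -- The span is invariant: the child of a node is a multiple of `v₀`, or lies in a hull, or is a
  -- vertex. Cyclicity makes it everything, and the increasing spans stabilize.
  have htop : Submodule.span ℝ (⋃ k, V k) = ⊤ := by
    refine hcyc _ (fun i x hx => ?_)
      (Submodule.subset_span (Set.mem_iUnion.2 ⟨0, initial_mem_ipaRun_V 0⟩))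
    have hle : Submodule.span ℝ (⋃ k, V k) ≤
        (Submodule.span ℝ (⋃ k, V k)).comap ((S.normalized p).A i).mulVecLin := by
      rw [Submodule.span_le]
      intro y hy
      obtain ⟨k, hk⟩ := Set.mem_iUnion.1 hy
      obtain ⟨l, -, w, hw, rfl⟩ := exists_of_mem_ipaRun_V hk
      rw [SetLike.mem_coe, Submodule.mem_comap, Matrix.mulVecLin_apply, ← ipaVector_cons]
      rcases ipaRun_child hw i with h | h | h
      · rw [h, ipaVector, hv]
        exact Submodule.smul_mem _ _
          (Submodule.subset_span (Set.mem_iUnion.2 ⟨0, initial_mem_ipaRun_V 0⟩))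
      · exact Submodule.span_mono (Set.subset_iUnion V (l + 1))
          (absConvexHull_subset_span _ (interior_subset h))
      · exact Submodule.subset_span (Set.mem_iUnion.2 ⟨l + 1, h.2⟩)
    exact hle hx
  obtain ⟨k₀, hk₀⟩ := monotone_stabilizes_iff_noetherian.2
    (inferInstance : IsNoetherian ℝ (Fin d → ℝ))
    ⟨fun k => Submodule.span ℝ (V k), fun a b hab =>
      Submodule.span_mono (S.ipaRun_V_monotone p v₀ hab)⟩
  have hk₀top : Submodule.span ℝ (V k₀) = ⊤ := by
    rw [← top_le_iff, ← htop, Submodule.span_le, Set.iUnion_subset_iff]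
    intro k
    have h1 : V k ⊆ V (max k₀ k) := S.ipaRun_V_monotone p v₀ (le_max_right _ _)
    have h2 : Submodule.span ℝ (V k₀) = Submodule.span ℝ (V (max k₀ k)) := hk₀ _ (le_max_left _ _)
    rw [h2]
    exact h1.trans Submodule.subset_span
  refine ⟨k₀, fun k hk => absConvexHull_mem_nhds_zero ?_ ⟨v₀, initial_mem_ipaRun_V k⟩⟩
  exact top_le_iff.1 (hk₀top ▸ Submodule.span_mono (S.ipaRun_V_monotone p v₀ hk))

end WeightedSystem

/-! ### Termination for bounded systems. -/

namespace WeightedSystem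

variable {d m : ℕ} {S : WeightedSystem d m} {p : List (Fin m)} {v₀ : Fin d → ℝ}

/-- An endless run yields an infinite path of added nodes, eventually outside the interior of a
fixed hull `P`. But `exists_pathWord_near_smul` brings it near `l • v₀` with `|l| ≤ 1 - η`, which is
well inside `P`. -/
theorem ipaTerminates_of_isBoundedSystem (hp : IsSimpleWord p) {γ : ℝ} (hγ : γ < 1)
    (hdom : ∀ w, ¬ IsPowerOfCyclicPerm p w →
      matSpectralRadius (wordProd (S.normalized p).A w) ≤ γ)
    {f : Fin d → ℝ} {c : ℝ} (hv0 : v₀ ≠ 0) (hv : (S.normalized p).product p *ᵥ v₀ = c • v₀)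
    (hdefl : matSpectralRadius ((S.normalized p).product p - c • Matrix.vecMulVec v₀ f) < 1)
    (hcyc : (S.normalized p).IsCyclicVector v₀) (hB : IsBoundedSystem (S.normalized p).A) :
    S.IPATerminates p v₀ := by
  by_contra hterm
  simp only [IPATerminates, not_exists] at hterm
  obtain ⟨k₀, hk₀⟩ := exists_absConvexHull_ipaRun_mem_nhds hv hcyc
  set P := absConvexHull ℝ (S.ipaRun p v₀ k₀).V with hP
  have hPnhds : P ∈ 𝓝 (0 : Fin d → ℝ) := hk₀ k₀ le_rfl
  have hPconv : Convex ℝ P := convex_absConvexHull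
  have hPabs : Absorbent ℝ P := absorbent_nhds_zero hPnhds
  obtain ⟨j, hj⟩ := exists_pathWord (Q := fun s => s ∈ (S.ipaRun p v₀ s.length).R)
    (fun u s h => mem_ipaRun_of_append h) (fun n => by
      obtain ⟨w, hw⟩ := List.exists_mem_of_ne_nil _ (hterm n)
      have hl := length_of_mem_ipaRun hw
      exact ⟨w, hl, hl ▸ hw⟩)
  have hout : ∀ k > k₀, S.ipaVector p v₀ (pathWord j k) ∉ interior P := by
    intro k hk hin
    obtain ⟨k, rfl⟩ : ∃ k', k = k' + 1 := ⟨k - 1, by omega⟩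
    have h1 := hj (k + 1)
    rw [length_pathWord] at h1
    exact (exists_of_mem_ipaRun_succ h1).2.2.1
      (interior_mono ((absConvexHull ℝ).monotone (S.ipaRun_V_monotone p v₀ (by omega))) hin)
  obtain ⟨r, hr, hball⟩ := Metric.mem_nhds_iff.1 hPnhds
  have hgauge : ∀ x, gauge P x ≤ ‖x‖ / r := fun x => by
    rw [le_div_iff₀ hr, mul_comm]; exact mul_gauge_le_norm hball
  have hfar : ∀ k > k₀, r ≤ ‖S.ipaVector p v₀ (pathWord j k)‖ := by
    intro k hk
    by_contra! hlt
    refine hout k hk ((gauge_lt_one_iff_mem_interior hPconv hPnhds).1 ((hgauge _).trans_lt ?_))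
    rwa [div_lt_one hr]
  set N := orbitSeminorm (S.normalized p).A with hNdef
  have hN : ∀ i x, N ((S.normalized p).A i *ᵥ x) ≤ N x := hB.orbitSeminorm_mulVec_le
  -- The bound is known for late times only; `N` does not increase along the path, so it holds at
  -- earlier times too.
  have hNfar : ∀ n, r ≤ N (wordProd (S.normalized p).A (pathWord j n) *ᵥ v₀) := by
    intro n
    obtain ⟨u, hu⟩ := pathWord_suffix j (le_max_left n (k₀ + 1))
    have h1 := hfar (max n (k₀ + 1)) (by omega)
    rw [← hu, ipaVector_append] at h1
    exact h1.trans ((hB.norm_le_orbitSeminorm _).trans (seminorm_wordProd_le hN _ _))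
  have hNv : 0 < N v₀ := (norm_pos_iff.2 hv0).trans_le (hB.norm_le_orbitSeminorm _)
  obtain ⟨η, hη, hnear⟩ := exists_pathWord_near_smul hp hγ hdom hv hdefl hN hNv hr hNfar
    (fun n => ne_of_mem_ipaRun hp.1 (hj n))
  obtain ⟨k, hk, l, hl, hkl⟩ := hnear (η * r / 2) (by positivity) (k₀ + 1)
  refine hout k (by omega) ((gauge_lt_one_iff_mem_interior hPconv hPnhds).1 ?_)
  set x := S.ipaVector p v₀ (pathWord j k) with hx
  have h1 : gauge P x ≤ gauge P (x - l • v₀) + gauge P (l • v₀) := by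
    simpa using gauge_add_le hPconv hPabs (x - l • v₀) (l • v₀)
  have h2 : gauge P (x - l • v₀) ≤ η / 2 := by
    refine (hgauge _).trans ?_
    rw [div_le_iff₀ hr]
    have : ‖x - l • v₀‖ ≤ η * r / 2 := hkl
    linarith
  have h3 : gauge P (l • v₀) ≤ 1 - η := by
    rw [gauge_smul balanced_absConvexHull]
    have h4 : gauge P v₀ ≤ 1 := gauge_le_one_of_mem (subset_absConvexHull (initial_mem_ipaRun_V _))
    exact (mul_le_of_le_one_right (norm_nonneg _) h4).trans hl
  linarith

/-! ### The invariant polytope of a terminating run. -/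

theorem ipaRun_eq_of_R_eq_nil {K : ℕ} (hK : (S.ipaRun p v₀ K).R = []) (n : ℕ) :
    S.ipaRun p v₀ (K + n) = S.ipaRun p v₀ K := by
  induction n with
  | zero => rfl
  | succ n ih =>
    rw [← add_assoc, ipaRun_succ, ih, ipaIterate, hK]
    simp only [List.flatMap_nil, List.foldl_nil]
    rw [← hK]

/-- The polytope produced by a terminating run: its gauge `N` is a norm contracted by all the
modes, and a child of a node in the finite tree `T` is `p`, or lies in `T`, or is interior. -/
theorem IPATerminates.exists_polytope (hp : p ≠ []) {c : ℝ} (hc : |c| = 1)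
    (hv : (S.normalized p).product p *ᵥ v₀ = c • v₀)
    (hcyc : (S.normalized p).IsCyclicVector v₀) (hterm : S.IPATerminates p v₀) :
    ∃ (N : Seminorm ℝ (Fin d → ℝ)) (T : Set (List (Fin m))) (K : ℕ) (R θ : ℝ),
      (∀ x, ‖x‖ ≤ R * N x) ∧ (∀ i x, N ((S.normalized p).A i *ᵥ x) ≤ N x) ∧
      [] ∈ T ∧ (∀ w ∈ T, w.length ≤ K) ∧ (∀ w ∈ T, ¬ p <:+ w) ∧ 0 ≤ θ ∧ θ < 1 ∧
      (∀ w ∈ T, ∀ i, i :: w = p ∨ N (S.ipaVector p v₀ (i :: w)) ≤ θ ∨ i :: w ∈ T) ∧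
      (∀ s : Set (Fin d → ℝ), AbsConvex ℝ s → (∀ w ∈ T, S.ipaVector p v₀ w ∈ s) →
        ∀ x, ∀ a > N x, ∃ y ∈ s, x = a • y) := by
  obtain ⟨K₁, hK₁⟩ := hterm
  obtain ⟨k₀, hk₀⟩ := exists_absConvexHull_ipaRun_mem_nhds hv hcyc
  obtain ⟨K, hKR, hKk⟩ : ∃ K, (S.ipaRun p v₀ K).R = [] ∧ k₀ ≤ K :=
    ⟨K₁ + k₀, by rw [ipaRun_eq_of_R_eq_nil hK₁, hK₁], by omega⟩
  set V := (S.ipaRun p v₀ K).V with hV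
  have hVle : ∀ k, (S.ipaRun p v₀ k).V ⊆ V := by
    intro k
    rcases le_total k K with h | h
    · exact S.ipaRun_V_monotone p v₀ h
    · obtain ⟨n, rfl⟩ := Nat.exists_eq_add_of_le h
      rw [ipaRun_eq_of_R_eq_nil hKR]
  set T : Set (List (Fin m)) := {w | w ∈ (S.ipaRun p v₀ w.length).R} with hT
  have hTK : ∀ w ∈ T, w.length ≤ K := by
    intro w hw
    by_contra! hlt
    obtain ⟨n, hn⟩ := Nat.exists_eq_add_of_le hlt.le
    rw [hT, Set.mem_ofPred, hn, ipaRun_eq_of_R_eq_nil hKR, hKR] at hw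
    simp at hw
  have hTV : ∀ w ∈ T, S.ipaVector p v₀ w ∈ V := fun w hw => hVle _ (ipaVector_mem_ipaRun hw)
  have hVT : ∀ x ∈ V, ∃ w ∈ T, x = S.ipaVector p v₀ w := by
    intro x hx
    obtain ⟨l, -, w, hw, rfl⟩ := exists_of_mem_ipaRun_V hx
    have := length_of_mem_ipaRun hw
    exact ⟨w, by rw [hT, Set.mem_ofPred, this]; exact hw, rfl⟩
  have hTfin : T.Finite := (List.finite_length_le (Fin m) K).subset hTK
  have hVfin : V.Finite := (hTfin.image (S.ipaVector p v₀)).subset fun x hx => by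
    obtain ⟨w, hw, rfl⟩ := hVT x hx
    exact ⟨w, hw, rfl⟩
  set P := absConvexHull ℝ V with hP
  have hPnhds : P ∈ 𝓝 (0 : Fin d → ℝ) := hk₀ K hKk
  have hPconv : Convex ℝ P := convex_absConvexHull
  have hPbal : Balanced ℝ P := balanced_absConvexHull
  have hPabs : Absorbent ℝ P := absorbent_nhds_zero hPnhds
  let N : Seminorm ℝ (Fin d → ℝ) := gaugeSeminorm hPbal hPconv hPabs
  have hNg : ∀ x, N x = gauge P x := fun x => rfl
  have hNV : ∀ x ∈ V, N x ≤ 1 := fun x hx => gauge_le_one_of_mem (subset_absConvexHull hx)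
  have hchild : ∀ w ∈ T, ∀ i, i :: w = p ∨ N (S.ipaVector p v₀ (i :: w)) < 1 ∨ i :: w ∈ T := by
    intro w hw i
    rcases ipaRun_child hw i with h | h | h
    · exact Or.inl h
    · exact Or.inr (Or.inl ((gauge_lt_one_iff_mem_interior hPconv hPnhds).2
        (interior_mono ((absConvexHull ℝ).monotone (hVle _)) h)))
    · exact Or.inr (Or.inr h.1)
  -- Since `N` is the gauge of the hull of the tree vectors, an absolutely convex condition need
  -- only be checked on those vectors.
  have hhull : ∀ s : Set (Fin d → ℝ), AbsConvex ℝ s → (∀ w ∈ T, S.ipaVector p v₀ w ∈ s) →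
        ∀ x, ∀ a > N x, ∃ y ∈ s, x = a • y := by
    intro s hs hsT x a ha
    have hPs : P ⊆ s := absConvexHull_min (fun y hy => by
      obtain ⟨w, hw, rfl⟩ := hVT y hy
      exact hsT w hw) hs
    obtain ⟨b, hb0, hba, y, hy, rfl⟩ := exists_lt_of_gauge_lt hPabs ha
    have ha0 : 0 < a := hb0.trans hba
    refine ⟨(b / a) • y, hPs (hPbal.smul_mem ?_ hy), ?_⟩
    · rw [Real.norm_of_nonneg (by positivity)]
      exact (div_le_one ha0).2 hba.le
    · rw [smul_smul, mul_div_cancel₀ _ ha0.ne']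
  obtain ⟨R, hR⟩ : ∃ R : ℝ, ∀ x ∈ V, ‖x‖ ≤ R := by
    obtain ⟨R, hR⟩ := (hVfin.image norm).bddAbove
    exact ⟨R, fun x hx => hR ⟨x, hx, rfl⟩⟩
  have hball : P ⊆ Metric.closedBall 0 R := by
    refine absConvexHull_min (fun x hx => by simpa using hR x hx)
      ⟨balanced_closedBall_zero, convex_closedBall _ _⟩
  have hR0 : 0 ≤ R := (norm_nonneg v₀).trans (hR v₀ (initial_mem_ipaRun_V K))
  -- The maximum of the finitely many values below one, with `0` inserted to make the set nonempty.
  obtain ⟨θ, hθ0, hθ1, hθ⟩ : ∃ θ : ℝ, 0 ≤ θ ∧ θ < 1 ∧ ∀ w ∈ T, ∀ i,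
      N (S.ipaVector p v₀ (i :: w)) < 1 → N (S.ipaVector p v₀ (i :: w)) ≤ θ := by
    have hfin : (insert 0 ((fun q : List (Fin m) × Fin m => N (S.ipaVector p v₀ (q.2 :: q.1))) ''
        (T ×ˢ Set.univ) ∩ Set.Iio 1)).Finite :=
      (((hTfin.prod Set.finite_univ).image _).inter_of_left _).insert 0
    obtain ⟨θ, hθmem, hθ⟩ := Set.exists_max_image _ id hfin ⟨0, Set.mem_insert _ _⟩
    refine ⟨θ, hθ 0 (Set.mem_insert _ _), ?_, fun w hw i hlt =>
      hθ _ (Set.mem_insert_of_mem _ ⟨⟨(w, i), ⟨hw, Set.mem_univ _⟩, rfl⟩, hlt⟩)⟩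
    rcases hθmem with rfl | h
    · exact zero_lt_one
    · exact h.2
  refine ⟨N, T, K, R, θ, fun x => ?_, fun i x => ?_, nil_mem_ipaRun_zero, hTK, fun w hw hsuf => ?_,
    hθ0, hθ1, fun w hw i => ?_, hhull⟩
  · rcases hR0.eq_or_lt with h0 | h0
    · obtain ⟨y, hy, hxy⟩ := hhull {0} ⟨balanced_zero, convex_singleton 0⟩
        (fun w hw => norm_le_zero_iff.1 (h0 ▸ hR _ (hTV w hw))) x (N x + 1) (by simp)
      rw [Set.mem_singleton_iff.1 hy, smul_zero] at hxy
      simp [hxy]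
    · have := le_gauge_of_subset_closedBall hPabs hR0 (x := x) hball
      rwa [div_le_iff₀ h0, mul_comm] at this
  · have hs : AbsConvex ℝ {y | N ((S.normalized p).A i *ᵥ y) ≤ 1} := by
      have h1 := (N.comp ((S.normalized p).A i).mulVecLin).balanced_closedBall_zero 1
      have h2 := (N.comp ((S.normalized p).A i).mulVecLin).convex_closedBall 0 1
      have h3 : (N.comp ((S.normalized p).A i).mulVecLin).closedBall 0 1 =
        {y | N ((S.normalized p).A i *ᵥ y) ≤ 1} := by
        ext y
        simp [Seminorm.mem_closedBall]
      rw [h3] at h1 h2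
      exact ⟨h1, h2⟩
    refine le_of_forall_gt_imp_ge_of_dense fun a ha => ?_
    obtain ⟨y, hy, rfl⟩ := hhull _ hs (fun w hw => by
      rw [Set.mem_ofPred, ← ipaVector_cons]
      rcases hchild w hw i with h | h | h
      · rw [h, ipaVector, hv, map_smul_eq_mul, Real.norm_eq_abs, hc, one_mul]
        exact hNV _ (initial_mem_ipaRun_V K)
      · exact h.le
      · exact hNV _ (hTV _ h)) x a ha
    rw [Matrix.mulVec_smul, map_smul_eq_mul, Real.norm_of_nonneg ((apply_nonneg N _).trans ha.le)]
    exact mul_le_of_le_one_right ((apply_nonneg N _).trans ha.le) hy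
  · obtain ⟨u, rfl⟩ := hsuf
    exact ne_of_mem_ipaRun hp (mem_ipaRun_of_append hw) rfl
  · rcases hchild w hw i with h | h | h
    · exact Or.inl h
    · exact Or.inr (Or.inl (hθ w hw i h))
    · exact Or.inr (Or.inr h)

end WeightedSystem

/-! ### Termination implies dominance and a unique simple leading eigenvalue. -/

namespace WeightedSystem

variable {d m : ℕ} {S : WeightedSystem d m} {p : List (Fin m)} {v₀ : Fin d → ℝ}

/-- A run along `w` from a node of the finite tree either becomes interior, or returns through
powers of `p` to a node of the tree. -/
theorem seminorm_le_or_append_eq {c : ℝ} (hc : |c| = 1)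
    (hv : (S.normalized p).product p *ᵥ v₀ = c • v₀) {N : Seminorm ℝ (Fin d → ℝ)}
    (hN : ∀ i x, N ((S.normalized p).A i *ᵥ x) ≤ N x) {T : Set (List (Fin m))} (hT : [] ∈ T)
    {θ : ℝ} (hchild : ∀ w ∈ T, ∀ i, i :: w = p ∨ N (S.ipaVector p v₀ (i :: w)) ≤ θ ∨ i :: w ∈ T)
    {u : List (Fin m)} (hu : u ∈ T) (w : List (Fin m)) :
    N (S.ipaVector p v₀ (w ++ u)) ≤ θ ∨
      ∃ u' ∈ T, ∃ j, w ++ u = u' ++ (List.replicate j p).flatten := by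
  induction w with
  | nil => exact Or.inr ⟨u, hu, 0, by simp⟩
  | cons i w ih =>
    rcases ih with h | ⟨u', hu', j, h⟩
    · left
      rw [List.cons_append, ipaVector_cons]
      exact (hN _ _).trans h
    · rcases hchild u' hu' i with h1 | h1 | h1
      -- Arriving at `p` restarts the walk at the root, with one more period recorded.
      · refine Or.inr ⟨[], hT, j + 1, ?_⟩
        rw [List.cons_append, h, List.replicate_succ, List.flatten_cons, ← List.cons_append, h1]
        simp
      · left
        have hpow : ∀ j : ℕ, ∃ σ : ℝ, |σ| = 1 ∧
            S.ipaVector p v₀ (List.replicate j p).flatten = σ • v₀ := by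
          intro j
          induction j with
          | zero => exact ⟨1, by simp, by simp⟩
          | succ j ih =>
            obtain ⟨σ, hσ, he⟩ := ih
            refine ⟨σ * c, by rw [abs_mul, hσ, hc, one_mul], ?_⟩
            rw [List.replicate_succ, List.flatten_cons, ipaVector_append, he, Matrix.mulVec_smul]
            have : wordProd (S.normalized p).A p *ᵥ v₀ = c • v₀ := hv
            rw [this, smul_smul]
        obtain ⟨σ, hσ, he⟩ := hpow j
        rw [List.cons_append, h, ← List.cons_append, ipaVector_append, he, Matrix.mulVec_smul,
          map_smul_eq_mul, Real.norm_eq_abs, hσ, one_mul]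
        exact h1
      · refine Or.inr ⟨i :: u', h1, j, ?_⟩
        rw [List.cons_append, h, List.cons_append]

/-- `hX` says that the gauge of the absolutely convex hull of `X` is at most `N`, so an operator
bound on `X` extends to all vectors. -/
theorem seminorm_le_mul_of_forall_mem {N : Seminorm ℝ (Fin d → ℝ)} {X : Set (Fin d → ℝ)}
    (hX : ∀ s : Set (Fin d → ℝ), AbsConvex ℝ s → X ⊆ s →
        ∀ x, ∀ a > N x, ∃ y ∈ s, x = a • y)
    {M : Matrix (Fin d) (Fin d) ℝ} {θ : ℝ} (hθ : 0 ≤ θ) (h : ∀ x ∈ X, N (M *ᵥ x) ≤ θ)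
    (x : Fin d → ℝ) : N (M *ᵥ x) ≤ θ * N x := by
  have hs : AbsConvex ℝ {y | N (M *ᵥ y) ≤ θ} := by
    have h1 := (N.comp M.mulVecLin).balanced_closedBall_zero θ
    have h2 := (N.comp M.mulVecLin).convex_closedBall 0 θ
    have h3 : (N.comp M.mulVecLin).closedBall 0 θ = {y | N (M *ᵥ y) ≤ θ} := by
      ext y
      simp [Seminorm.mem_closedBall]
    rw [h3] at h1 h2
    exact ⟨h1, h2⟩
  refine le_of_forall_pos_le_add fun ε hε => ?_
  obtain ⟨y, hy, hxy⟩ := hX _ hs h x (N x + ε / (θ + 1)) (by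
    have : 0 < ε / (θ + 1) := by positivity
    linarith)
  have ha : 0 ≤ N x + ε / (θ + 1) := by positivity
  conv_lhs => rw [hxy]
  rw [Matrix.mulVec_smul, map_smul_eq_mul, Real.norm_of_nonneg ha]
  calc (N x + ε / (θ + 1)) * N (M *ᵥ y) ≤ (N x + ε / (θ + 1)) * θ :=
        mul_le_mul_of_nonneg_left hy ha
    _ = θ * N x + ε * (θ / (θ + 1)) := by ring
    _ ≤ θ * N x + ε * 1 := by
        gcongr
        rw [div_le_one (by positivity)]
        linarith
    _ = _ := by rw [mul_one]

theorem IPATerminates.isDominant (hd : 0 < d) (hp : IsSimpleWord p) {c : ℝ}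
    (hc : |c| = 1) (hv : (S.normalized p).product p *ᵥ v₀ = c • v₀)
    (hcyc : (S.normalized p).IsCyclicVector v₀) (hterm : S.IPATerminates p v₀) :
    S.IsDominant p := by
  obtain ⟨N, T, K, R, θ, hR, hN, hnil, hTK, -, hθ0, hθ1, hchild, hhull⟩ :=
    hterm.exists_polytope hp.1 hc hv hcyc
  set s := p.length + K with hs
  have hs0 : 0 < s := by have := hp.length_pos; omega
  -- The exponent `s` meets the overlap requirement of `IsSimpleWord.isPowerOfCyclicPerm` for every
  -- `w`, so `γ` does not depend on `w`.
  obtain ⟨γ, hγ0, hγ1, hγ⟩ : ∃ γ : ℝ, 0 < γ ∧ γ < 1 ∧ θ < γ ^ s := by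
    have hlim : Tendsto (fun γ : ℝ => γ ^ s) (𝓝[<] 1) (𝓝 1) := by
      have := (continuous_pow (M := ℝ) s).tendsto 1
      rw [one_pow] at this
      exact this.mono_left nhdsWithin_le_nhds
    obtain ⟨γ, h1, h2⟩ := ((hlim.eventually_const_lt hθ1).and
      (Ioo_mem_nhdsLT (show (0 : ℝ) < 1 by norm_num))).exists
    exact ⟨γ, h2.1, h2.2, h1⟩
  refine ⟨γ, hγ1, fun w hw => ?_⟩
  have hw0 : w ≠ [] := by
    rintro rfl
    exact hw ⟨p, List.IsRotated.refl p, 0, by simp⟩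
  set M := wordProd (S.normalized p).A w with hM
  have hcontr : ∀ x, N (M ^ s *ᵥ x) ≤ θ * N x := by
    refine seminorm_le_mul_of_forall_mem (X := S.ipaVector p v₀ '' T)
      (fun t ht hTt => hhull t ht fun u hu => hTt ⟨u, hu, rfl⟩) hθ0 ?_
    rintro _ ⟨u, hu, rfl⟩
    rw [hM, ← wordProd_power, ← ipaVector_append]
    rcases seminorm_le_or_append_eq hc hv hN hnil hchild hu (List.replicate s w).flatten with
      h | ⟨u', hu', j, h⟩
    · exact h
    · exact absurd (hp.isPowerOfCyclicPerm hw0 (by have := hTK u' hu'; omega) h) hw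
  have hiter : ∀ k x, N ((M ^ s) ^ k *ᵥ x) ≤ θ ^ k * N x := by
    intro k x
    induction k with
    | zero => simp
    | succ k ih =>
      rw [pow_succ', ← Matrix.mulVec_mulVec, pow_succ', mul_assoc]
      exact (hcontr _).trans (mul_le_mul_of_nonneg_left ih hθ0)
  have hlt : matSpectralRadius (γ⁻¹ • M) < 1 := by
    refine matSpectralRadius_lt_one_of_tendsto hd (f := fun k => s * k) fun x => ?_
    rw [tendsto_zero_iff_norm_tendsto_zero]
    have hlim : Tendsto (fun k => |R| * ((θ / γ ^ s) ^ k * N x)) atTop (𝓝 (|R| * (0 * N x))) :=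
      ((tendsto_pow_atTop_nhds_zero_of_lt_one (by positivity)
        ((div_lt_one (by positivity)).2 hγ)).mul_const _).const_mul _
    rw [zero_mul, mul_zero] at hlim
    refine squeeze_zero (fun k => norm_nonneg _) (fun k => ?_) hlim
    refine (hR _).trans (mul_le_mul (le_abs_self R) ?_ (apply_nonneg _ _) (abs_nonneg _))
    rw [_root_.smul_pow, Matrix.smul_mulVec, map_smul_eq_mul, Real.norm_of_nonneg (by positivity),
      pow_mul, pow_mul, inv_pow]
    calc ((γ ^ s)⁻¹) ^ k * N ((M ^ s) ^ k *ᵥ x) ≤ ((γ ^ s)⁻¹) ^ k * (θ ^ k * N x) := by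
          gcongr; exact hiter k x
      _ = _ := by rw [div_pow, inv_pow]; ring
  rw [matSpectralRadius_smul, abs_of_pos (by positivity), inv_mul_lt_iff₀ hγ0, mul_one] at hlt
  exact hlt

/-- Under a high power of the candidate product, every tree vector except `v₀` enters the shrunken
polytope, and `v₀` is zero modulo its own line. So this power contracts modulo that line, on which
the deflation vanishes. -/
theorem IPATerminates.matSpectralRadius_deflation_lt_one (hd : 0 < d) (hp : IsSimpleWord p) {c : ℝ}
    (hc : |c| = 1) (hv : (S.normalized p).product p *ᵥ v₀ = c • v₀) {f : Fin d → ℝ}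
    (hf : f ⬝ᵥ v₀ = 1) (hcyc : (S.normalized p).IsCyclicVector v₀) (hterm : S.IPATerminates p v₀) :
    matSpectralRadius ((S.normalized p).product p - c • Matrix.vecMulVec v₀ f) < 1 := by
  obtain ⟨N, T, K, R, θ, hR, hN, hnil, hTK, hTp, hθ0, hθ1, hchild, hhull⟩ :=
    hterm.exists_polytope hp.1 hc hv hcyc
  set M := (S.normalized p).product p with hM
  set D := M - c • Matrix.vecMulVec v₀ f with hD
  have hDv : D *ᵥ v₀ = 0 := by
    rw [hD, Matrix.sub_mulVec, hv, Matrix.smul_mulVec, Matrix.vecMulVec_mulVec, hf]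
    simp
  have hDpowv : ∀ n, 0 < n → ∀ a : ℝ, D ^ n *ᵥ (a • v₀) = 0 := by
    intro n hn a
    obtain ⟨n, rfl⟩ := Nat.exists_eq_succ_of_ne_zero hn.ne'
    rw [Nat.succ_eq_add_one, pow_succ, ← Matrix.mulVec_mulVec, Matrix.mulVec_smul, hDv, smul_zero,
      Matrix.mulVec_zero]
  set n := K + 1 with hn
  set s : Set (Fin d → ℝ) := {x | ∃ a : ℝ, N (M ^ n *ᵥ x - a • v₀) ≤ θ} with hs
  have hsabs : AbsConvex ℝ s := by
    constructor
    · rintro a ha _ ⟨x, ⟨b, hb⟩, rfl⟩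
      refine ⟨a * b, ?_⟩
      have : M ^ n *ᵥ (a • x) - (a * b) • v₀ = a • (M ^ n *ᵥ x - b • v₀) := by
        rw [Matrix.mulVec_smul, smul_sub, smul_smul]
      simp only [this, map_smul_eq_mul]
      exact (mul_le_of_le_one_left (apply_nonneg _ _) ha).trans hb
    · rintro x ⟨a, ha⟩ y ⟨b, hb⟩ r t hr ht hrt
      refine ⟨r * a + t * b, ?_⟩
      have : M ^ n *ᵥ (r • x + t • y) - (r * a + t * b) • v₀ =
          r • (M ^ n *ᵥ x - a • v₀) + t • (M ^ n *ᵥ y - b • v₀) := by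
        rw [Matrix.mulVec_add, Matrix.mulVec_smul, Matrix.mulVec_smul, add_smul, mul_smul, mul_smul,
          smul_sub, smul_sub]
        abel
      rw [this]
      refine (map_add_le_add N _ _).trans ?_
      rw [map_smul_eq_mul, map_smul_eq_mul, Real.norm_of_nonneg hr, Real.norm_of_nonneg ht]
      calc _ ≤ r * θ + t * θ := by gcongr
        _ = θ := by rw [← add_mul, hrt, one_mul]
  have hsT : ∀ u ∈ T, S.ipaVector p v₀ u ∈ s := by
    intro u hu
    have hMw : M ^ n *ᵥ S.ipaVector p v₀ u =
        S.ipaVector p v₀ ((List.replicate n p).flatten ++ u) := by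
      rw [ipaVector_append, wordProd_power]
      rfl
    rcases seminorm_le_or_append_eq hc hv hN hnil hchild hu (List.replicate n p).flatten with
      h | ⟨u', hu', j, h⟩
    · refine ⟨0, ?_⟩
      rw [hMw, zero_smul, sub_zero]
      exact h
    · have hu0 : u = [] := hp.eq_nil_of_append_eq (hTp u hu) (by
        have h1 := hTK u' hu'
        have h2 := hp.length_pos
        nlinarith) h
      subst hu0
      obtain ⟨a, ha⟩ := exists_pow_mulVec_eq_deflation M f hv v₀ n
      refine ⟨a, ?_⟩
      rw [ipaVector_nil, ha, add_sub_cancel_right]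
      have := hDpowv n (by omega) 1
      rw [one_smul] at this
      rw [this, map_zero]
      exact hθ0
  -- The hull property only gives scales strictly larger than `N x`; the room between `θ` and `θ'`
  -- absorbs this.
  set θ' := (1 + θ) / 2 with hθ'
  have hθ'0 : 0 ≤ θ' := by positivity
  have hθ'1 : θ' < 1 := by rw [hθ']; linarith
  have hstep : ∀ x, ∃ a : ℝ, N (D ^ n *ᵥ x - a • v₀) ≤ θ' * N x := by
    intro x
    rcases (apply_nonneg N x).eq_or_lt with h0 | h0
    · have h1 := hR x
      rw [← h0, mul_zero] at h1
      have : x = 0 := norm_le_zero_iff.1 h1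
      exact ⟨0, by simp [this]⟩
    · rcases hθ0.eq_or_lt with hz | hz
      · obtain ⟨y, ⟨b, hb⟩, hxy⟩ := hhull s hsabs hsT x (2 * N x) (by linarith)
        obtain ⟨e, he⟩ := exists_pow_mulVec_eq_deflation M f hv x n
        refine ⟨2 * N x * b - e, ?_⟩
        have h1 : D ^ n *ᵥ x - (2 * N x * b - e) • v₀ = (2 * N x) • (M ^ n *ᵥ y - b • v₀) := by
          rw [smul_sub, ← Matrix.mulVec_smul, ← hxy, he, sub_smul, mul_smul]
          abel
        rw [h1, map_smul_eq_mul, Real.norm_of_nonneg (by positivity)]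
        have : N (M ^ n *ᵥ y - b • v₀) = 0 := le_antisymm (hz ▸ hb) (apply_nonneg _ _)
        rw [this, mul_zero]
        positivity
      · obtain ⟨y, ⟨b, hb⟩, hxy⟩ := hhull s hsabs hsT x (θ' / θ * N x) (by
          rw [gt_iff_lt]
          refine lt_mul_of_one_lt_left h0 ((one_lt_div hz).2 ?_)
          rw [hθ']; linarith)
        obtain ⟨e, he⟩ := exists_pow_mulVec_eq_deflation M f hv x n
        refine ⟨θ' / θ * N x * b - e, ?_⟩
        have h1 : D ^ n *ᵥ x - (θ' / θ * N x * b - e) • v₀ =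
            (θ' / θ * N x) • (M ^ n *ᵥ y - b • v₀) := by
          rw [smul_sub, ← Matrix.mulVec_smul, ← hxy, he, sub_smul, mul_smul]
          abel
        rw [h1, map_smul_eq_mul, Real.norm_of_nonneg (by positivity)]
        calc _ ≤ θ' / θ * N x * θ := by gcongr
          _ = θ' * N x := by field_simp
  have hiter : ∀ k x, ∃ a : ℝ, N (D ^ (n * k) *ᵥ x - a • v₀) ≤ θ' ^ k * N x := by
    intro k x
    induction k with
    | zero => exact ⟨0, by simp⟩
    | succ k ih =>
      obtain ⟨a, ha⟩ := ih
      obtain ⟨b, hb⟩ := hstep (D ^ (n * k) *ᵥ x - a • v₀)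
      refine ⟨b, ?_⟩
      rw [Matrix.mulVec_sub, hDpowv n (by omega), sub_zero, Matrix.mulVec_mulVec, ← pow_add] at hb
      rw [show n * (k + 1) = n + n * k by ring, pow_succ', mul_assoc]
      exact hb.trans (mul_le_mul_of_nonneg_left ha hθ'0)
  obtain ⟨C, hC0, hC⟩ := ((normSeminorm ℝ (Fin d → ℝ)).comp D.mulVecLin).exists_le_mul_norm
  -- The extra factor `D` kills the uncontrolled multiple of `v₀`.
  refine matSpectralRadius_lt_one_of_tendsto hd (f := fun k => n * k + 1) fun x => ?_
  rw [tendsto_zero_iff_norm_tendsto_zero]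
  have hlim : Tendsto (fun k => C * (|R| * (θ' ^ k * N x))) atTop (𝓝 (C * (|R| * (0 * N x)))) :=
    (((tendsto_pow_atTop_nhds_zero_of_lt_one hθ'0 hθ'1).mul_const _).const_mul _).const_mul _
  rw [zero_mul, mul_zero, mul_zero] at hlim
  refine squeeze_zero (fun k => norm_nonneg _) (fun k => ?_) hlim
  obtain ⟨a, ha⟩ := hiter k x
  have h1 : D ^ (n * k + 1) *ᵥ x = D *ᵥ (D ^ (n * k) *ᵥ x - a • v₀) := by
    rw [Matrix.mulVec_sub, Matrix.mulVec_smul, hDv, smul_zero, sub_zero, pow_succ',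
      Matrix.mulVec_mulVec]
  rw [h1]
  refine (hC _).trans (mul_le_mul_of_nonneg_left ?_ hC0.le)
  exact (hR _).trans (mul_le_mul (le_abs_self R) ha (apply_nonneg _ _) (abs_nonneg _))

/-! ### Normalization of the weighted system, and the theorem. -/

theorem dilate_product (S : WeightedSystem d m) {r : ℝ} (hr : 0 < r) (w : List (Fin m)) :
    (S.dilate r).product w = r ^ S.weight w • S.product w := by
  induction w with
  | nil => simp [product, weight]
  | cons i w ih =>
    have h1 : (S.dilate r).product (i :: w) = (r ^ S.α i • S.A i) * (S.dilate r).product w := by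
      simp [product, dilate]
    have h2 : S.product (i :: w) = S.A i * S.product w := by simp [product]
    have h3 : S.weight (i :: w) = S.α i + S.weight w := by simp [weight]
    rw [h1, ih, h2, h3, Real.rpow_add hr, Matrix.smul_mul, Matrix.mul_smul, smul_smul]

theorem weight_pos (S : WeightedSystem d m) {w : List (Fin m)} (hw : w ≠ []) : 0 < S.weight w :=
  List.sum_pos _ (fun x hx => by
    obtain ⟨i, -, rfl⟩ := List.mem_map.1 hx
    exact S.α_pos i) (by simpa using hw)

theorem candidateRadius_pos (hpos : 0 < matSpectralRadius (S.product p)) :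
    0 < S.candidateRadius p :=
  Real.rpow_pos_of_pos hpos _

theorem normalized_product_self (hp : p ≠ []) (hpos : 0 < matSpectralRadius (S.product p)) :
    (S.normalized p).product p = (matSpectralRadius (S.product p))⁻¹ • S.product p := by
  rw [normalized, dilate_product _ (inv_pos.2 (candidateRadius_pos hpos)),
    Real.inv_rpow (candidateRadius_pos hpos).le, candidateRadius, ← Real.rpow_mul hpos.le,
    one_div, inv_mul_cancel₀ (S.weight_pos hp).ne', Real.rpow_one]

theorem IsCyclicVector.normalized (hcyc : S.IsCyclicVector v₀)
    (hpos : 0 < matSpectralRadius (S.product p)) : (S.normalized p).IsCyclicVector v₀ := by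
  refine fun W hW hv => hcyc W (fun i x hx => ?_) hv
  have h1 : (S.candidateRadius p)⁻¹ ^ S.α i • (S.A i *ᵥ x) ∈ W := by
    rw [← Matrix.smul_mulVec]
    exact hW i x hx
  exact (W.smul_mem_iff
    (Real.rpow_pos_of_pos (inv_pos.2 (candidateRadius_pos hpos)) _).ne').1 h1

end WeightedSystem

theorem mainTheorem7 {d m : ℕ} (S : WeightedSystem d m) (p : List (Fin m))
    (hp : IsSimpleWord p) (hpos : 0 < matSpectralRadius (S.product p)) :
    (∀ v₀ : Fin d → ℝ, IsLeadingEigenvector (S.product p) v₀ → S.IsCyclicVector v₀ →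
      (S.IPATerminates p v₀ ↔
        S.IsDominant p ∧ HasUniqueSimpleLeadingEigenvalue (S.product p))) ∧
    (HasUniqueSimpleLeadingEigenvalue (S.product p) →
      ∃ v₀ : Fin d → ℝ, IsLeadingEigenvector (S.product p) v₀) := by
  refine ⟨fun v₀ hv₀ hcyc => ?_, fun h => h.exists_isLeadingEigenvector⟩
  obtain ⟨hv0, c₀, hc₀, hv⟩ := hv₀
  have hd : 0 < d := by
    rcases Nat.eq_zero_or_pos d with h | h
    · rw [matSpectralRadius_of_dim_zero h] at hpos
      exact absurd hpos (lt_irrefl 0)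
    · exact h
  set ρ := matSpectralRadius (S.product p) with hρ
  -- Any functional with value one at `v₀` would do.
  set f : Fin d → ℝ := (v₀ ⬝ᵥ v₀)⁻¹ • v₀ with hf
  have hfv : f ⬝ᵥ v₀ = 1 := by
    rw [hf, smul_dotProduct, smul_eq_mul, inv_mul_cancel₀]
    simpa using hv0
  have hprod := WeightedSystem.normalized_product_self hp.1 hpos
  rw [← hρ] at hprod
  set c := ρ⁻¹ * c₀ with hc
  have hcabs : |c| = 1 := by
    rw [hc, abs_mul, abs_of_pos (inv_pos.2 hpos), hc₀, inv_mul_cancel₀ hpos.ne']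
  have hvn : (S.normalized p).product p *ᵥ v₀ = c • v₀ := by
    rw [hprod, Matrix.smul_mulVec, hv, smul_smul]
  have hcycn := hcyc.normalized hpos
  -- The deflation of the normalized product is `ρ⁻¹` times that of the product itself.
  have hunique : HasUniqueSimpleLeadingEigenvalue (S.product p) ↔
      matSpectralRadius ((S.normalized p).product p - c • Matrix.vecMulVec v₀ f) < 1 := by
    rw [hasUniqueSimpleLeadingEigenvalue_iff_deflation hd hc₀ hpos hv hfv, hprod, hc, mul_smul,
      ← smul_sub, matSpectralRadius_smul, abs_of_pos (inv_pos.2 hpos), inv_mul_lt_iff₀ hpos, mul_one]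
  constructor
  · intro hterm
    exact ⟨hterm.isDominant hd hp hcabs hvn hcycn,
      hunique.2 (hterm.matSpectralRadius_deflation_lt_one hd hp hcabs hvn hfv hcycn)⟩
  · rintro ⟨⟨γ, hγ, hdom⟩, hus⟩
    have hdefl := hunique.1 hus
    have hdom' : ∀ w, ¬ IsPowerOfCyclicPerm p w →
        matSpectralRadius (wordProd (S.normalized p).A w) ≤ γ := fun w hw => (hdom w hw).le
    have hone : matSpectralRadius (wordProd (S.normalized p).A p) ≤ 1 := by
      change matSpectralRadius ((S.normalized p).product p) ≤ 1
      rw [hprod, matSpectralRadius_smul, abs_of_pos (inv_pos.2 hpos), inv_mul_cancel₀ hpos.ne']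
    exact WeightedSystem.ipaTerminates_of_isBoundedSystem hp hγ hdom' hv0 hvn hdefl hcycn
      (isBoundedSystem_of_dominant hp hγ hdom' hone hcabs hvn hdefl hcycn)
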